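/- **Theorem.** Let $\frac13<\beta<\gamma<H<\frac12$, $r>0$, $d\in\mathbb N$, and let $W$ be a finite-dimensional normed space over $\mathbb R$. Let $(\Omega,\mathcal F,\mathbb P,(\theta_t)_{t\in\mathbb R})$ be an ergodic measurable metric dynamical system and let $\mathbf B=(B,\mathbb B,\mathbb B(-r))$ be a delayed $\gamma$-rough path cocycle over it: for every $\omega$, $B(\omega):\mathbb R\to\mathbb R^d$ is locally $\gamma$-Hölder, $\mathbb B(\omega),\mathbb B(-r)(\omega):\mathbb R^2\to\mathbb R^d\otimes\mathbb R^d$ are continuous, locally $2\gamma$-Hölder, and satisfy $$\mathbb B_{s,t}=\mathbb B_{s,u}+\mathbb B_{u,t}+B_{s,u}\otimes B_{u,t}\quad(s,u,t\in\mathbb R),$$ $$\mathbb B_{s,t}(-r)=\mathbb B_{s,u}(-r)+\mathbb B_{u,t}(-r)+B_{s-r,u-r}\otimes B_{u,t}\quad(s<u<t),$$ where $B_{s,t}=B_t-B_s$; all these are measurable in $\omega$; and $\mathbf B_{s,s+t}(\omega)=\mathbf B_{0,t}(\theta_s\omega)$ for all $s,t\in\mathbb R$, $\omega\in\Omega$ (for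 the increment of $B$ and both areas). Assume that, under $\mathbb P$, $B$ is a two-sided $d$-dimensional fractional Brownian motion with Hurst parameter $H$ and that $\mathbb B_{s,t}=\int_s^tB_{s,u}\otimes\mathrm d^\circ B_u$ $(s,t\in\mathbb R)$ and $\mathbb B_{s,t}(-r)=\int_s^tB_{s-r,u-r}\otimes\mathrm d^\circ B_u$ $(s\le t)$ are symmetric integrals, $\int_s^tu_x\,\mathrm d^\circ B^j_x:=L^2(\mathbb P)\text{-}\lim_{\epsilon\downarrow0}\int_s^tu_x\frac{B^j_{x+\epsilon}-B^j_{x-\epsilon}}{2\epsilon}\,\mathrm dx$. For $\alpha\in\{\beta,\gamma\}$ let $\mathscr D^\alpha_{\mathbf B(\omega)}([-r,0])$ be the space of pairs $(m,m')$, $m:[-r,0]\to W$, $m':[-r,0]\to L(\mathbb R^d,W)$, for which $$\|(m,m')\|_{\mathscr D^\alpha_{\mathbf B(\omega)}}=\|m\|_\infty+\|m'\|_\infty+\sup_{s\ne t}\frac{|m'_t-m'_s|}{|t-s|^\alpha}+\sup_{s\neq t}\frac{|m^\#_{s,t}|}{|t-s|^{2\alpha}}<\infty,$$ where $m^\#_{s,t}=m_t-m_s-m'_sB_{s,t}(\omega)$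 and $s,t$ range over $[-r,0]$. Then $\mathscr D^\gamma_{\mathbf B(\omega)}([-r,0])\subset\mathscr D^\beta_{\mathbf B(\omega)}([-r,0])$. Let $E_\omega=\mathscr D^{\beta,\gamma}_{\mathbf B(\omega)}([-r,0])$ be the closure of $\mathscr D^\gamma_{\mathbf B(\omega)}([-r,0])$ in $\mathscr D^\beta_{\mathbf B(\omega)}([-r,0])$, with the norm of the latter. Then $\{E_\omega\}_{\omega\in\Omega}$ is a measurable field of Banach spaces: every $E_\omega$ is complete, and there is a linear subspace $\Delta\subset\prod_{\omega}E_\omega$ such that 1. there is a countable $\Delta_0\subset\Delta$ such that $\{g(\omega):g\in\Delta_0\}$ is dense in $E_\omega$ for every $\omega$; 2. $\omega\mapsto\|g(\omega)\|_{E_\omega}$ is measurable for every $g\in\Delta$. Moreover, let $0<\epsilon\le1-2\beta$, and let $C^{0,1-\epsilon}$ denote the closure of the smooth functions on $[-r,0]$ under the $(1-\epsilon)$-Hölder norm $\|\cdot\|_\infty+\|\cdot\|_{1-\epsilon}$. For all $f\in C^{0,1-\epsilon}([-r,0],L(\mathbb R^d,W))$ and $g\in C^{0,1-\epsilon}([-r,0],W)$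 the Young integrals $\int_{-r}^tf\,\mathrm dB(\omega)$ exist and $\Gamma_\omega(f,g)=\bigl(t\mapsto\int_{-r}^tf\,\mathrm dB(\omega)+g_t,\ f\bigr)$ lies in $E_\omega$ for every $\omega$; and one may take $\Delta=\{(\Gamma_\omega(f,g))_{\omega\in\Omega}: f,g\in C^{0,1-\epsilon}\}$. -/

import Mathlib

open MeasureTheory ProbabilityTheory Filter Topology Set

/-! ## Suprema of families of seminorms -/

theorem ctrl_bdd_add {V ι : Type*} [AddCommGroup V] {q : ι → V → ℝ}
    (hadd : ∀ i x y, q i (x + y) ≤ q i x + q i y) {x y : V}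
    (hx : BddAbove (range fun i => q i x)) (hy : BddAbove (range fun i => q i y)) :
    BddAbove (range fun i => q i (x + y)) := by
  obtain ⟨A, hA⟩ := hx
  obtain ⟨B, hB⟩ := hy
  refine ⟨A + B, ?_⟩
  rintro _ ⟨i, rfl⟩
  exact (hadd i x y).trans (add_le_add (hA ⟨i, rfl⟩) (hB ⟨i, rfl⟩))

theorem ctrl_bdd_smul {V ι : Type*} [AddCommGroup V] [Module ℝ V] {q : ι → V → ℝ}
    (hsmul : ∀ i (c : ℝ) x, q i (c • x) = |c| * q i x) (c : ℝ) {x : V}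
    (hx : BddAbove (range fun i => q i x)) :
    BddAbove (range fun i => q i (c • x)) := by
  obtain ⟨A, hA⟩ := hx
  refine ⟨|c| * A, ?_⟩
  rintro _ ⟨i, rfl⟩
  exact (hsmul i c x).le.trans (mul_le_mul_of_nonneg_left (hA ⟨i, rfl⟩) (abs_nonneg c))

theorem ctrl_sup_add {V ι : Type*} [AddCommGroup V] {q : ι → V → ℝ}
    (hnn : ∀ i x, 0 ≤ q i x)
    (hadd : ∀ i x y, q i (x + y) ≤ q i x + q i y) {x y : V}
    (hx : BddAbove (range fun i => q i x)) (hy : BddAbove (range fun i => q i y)) :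
    (⨆ i, q i (x + y)) ≤ (⨆ i, q i x) + ⨆ i, q i y :=
  Real.iSup_le (fun i => (hadd i x y).trans (add_le_add (le_ciSup hx i) (le_ciSup hy i)))
    (add_nonneg (Real.iSup_nonneg fun i => hnn i x) (Real.iSup_nonneg fun i => hnn i y))

theorem ctrl_sup_smul {V ι : Type*} [AddCommGroup V] [Module ℝ V] {q : ι → V → ℝ}
    (hsmul : ∀ i (c : ℝ) x, q i (c • x) = |c| * q i x) (c : ℝ) (x : V) :
    (⨆ i, q i (c • x)) = |c| * ⨆ i, q i x := by
  rw [Real.mul_iSup_of_nonneg (abs_nonneg c)]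
  exact iSup_congr fun i => hsmul i c x

/-! ## Controlled paths -/

section ControlledPaths

variable {E W : Type*} [NormedAddCommGroup E] [NormedSpace ℝ E]
  [NormedAddCommGroup W] [NormedSpace ℝ W]

/-- Candidates for controlled paths over `[a, b]`: a path `m` in `W` together with a path `m'` in
`L(E, W)`. -/
abbrev PathPair (E W : Type*) [NormedAddCommGroup E] [NormedSpace ℝ E]
    [NormedAddCommGroup W] [NormedSpace ℝ W] (a b : ℝ) : Type _ :=
  (Icc a b → W) × (Icc a b → E →L[ℝ] W)

/-- The remainder `m^#_{s,t} = m_t - m_s - m'_s (X_t - X_s)`. -/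
def ctrlRemainder {a b : ℝ} (X : ℝ → E) (x : PathPair E W a b) (s t : Icc a b) : W :=
  x.1 t - x.1 s - x.2 s (X t - X s)

/-- The quotient whose supremum over `(s, t)` is the `β`-Hölder seminorm of `m'`. The pairs with
`s = t` contribute `0`, so they do not influence the supremum. -/
noncomputable def derivQuot {a b : ℝ} (β : ℝ) (p : Icc a b × Icc a b) (x : PathPair E W a b) : ℝ :=
  ‖x.2 p.2 - x.2 p.1‖ / |(p.2 : ℝ) - p.1| ^ β

/-- The quotient whose supremum over `(s, t)` is the `2β`-Hölder seminorm of `m^#`. The pairs with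
`s = t` contribute `0`, so they do not influence the supremum. -/
noncomputable def remQuot {a b : ℝ} (X : ℝ → E) (β : ℝ) (p : Icc a b × Icc a b)
    (x : PathPair E W a b) : ℝ :=
  ‖ctrlRemainder X x p.1 p.2‖ / |(p.2 : ℝ) - p.1| ^ (2 * β)

theorem ctrlRemainder_add {a b : ℝ} (X : ℝ → E) (x y : PathPair E W a b) (s t : Icc a b) :
    ctrlRemainder X (x + y) s t = ctrlRemainder X x s t + ctrlRemainder X y s t := by
  simp only [ctrlRemainder, Prod.fst_add, Prod.snd_add, Pi.add_apply,
    _root_.add_apply]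
  abel

theorem ctrlRemainder_smul {a b : ℝ} (X : ℝ → E) (c : ℝ) (x : PathPair E W a b) (s t : Icc a b) :
    ctrlRemainder X (c • x) s t = c • ctrlRemainder X x s t := by
  simp only [ctrlRemainder, Prod.smul_fst, Prod.smul_snd, Pi.smul_apply,
    _root_.smul_apply, smul_sub]

theorem derivQuot_nonneg {a b : ℝ} (β : ℝ) (p : Icc a b × Icc a b) (x : PathPair E W a b) :
    0 ≤ derivQuot β p x := by
  unfold derivQuot; positivity

theorem derivQuot_add {a b : ℝ} (β : ℝ) (p : Icc a b × Icc a b) (x y : PathPair E W a b) :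
    derivQuot β p (x + y) ≤ derivQuot β p x + derivQuot β p y := by
  unfold derivQuot
  rw [← add_div]
  refine div_le_div_of_nonneg_right ?_ (by positivity)
  have : (x + y).2 p.2 - (x + y).2 p.1 = (x.2 p.2 - x.2 p.1) + (y.2 p.2 - y.2 p.1) := by
    simp only [Prod.snd_add, Pi.add_apply]; abel
  rw [this]
  exact norm_add_le _ _

theorem derivQuot_smul {a b : ℝ} (β : ℝ) (p : Icc a b × Icc a b) (c : ℝ) (x : PathPair E W a b) :
    derivQuot β p (c • x) = |c| * derivQuot β p x := by
  unfold derivQuot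
  have : (c • x).2 p.2 - (c • x).2 p.1 = c • (x.2 p.2 - x.2 p.1) := by
    simp only [Prod.smul_snd, Pi.smul_apply, smul_sub]
  rw [this, norm_smul, Real.norm_eq_abs, mul_div_assoc]

theorem remQuot_nonneg {a b : ℝ} (X : ℝ → E) (β : ℝ) (p : Icc a b × Icc a b)
    (x : PathPair E W a b) : 0 ≤ remQuot X β p x := by
  unfold remQuot; positivity

theorem remQuot_add {a b : ℝ} (X : ℝ → E) (β : ℝ) (p : Icc a b × Icc a b)
    (x y : PathPair E W a b) :
    remQuot X β p (x + y) ≤ remQuot X β p x + remQuot X β p y := by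
  unfold remQuot
  rw [← add_div, ctrlRemainder_add]
  exact div_le_div_of_nonneg_right (norm_add_le _ _) (by positivity)

theorem remQuot_smul {a b : ℝ} (X : ℝ → E) (β : ℝ) (p : Icc a b × Icc a b) (c : ℝ)
    (x : PathPair E W a b) : remQuot X β p (c • x) = |c| * remQuot X β p x := by
  unfold remQuot
  rw [ctrlRemainder_smul, norm_smul, Real.norm_eq_abs, mul_div_assoc]

/-- The pairs `(m, m')` over `[a, b]` for which the four quantities
`‖m‖_∞`, `‖m'‖_∞`, `‖m'‖_β`, `‖m^#‖_{2β}` are finite. -/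
def controlledSubmodule (X : ℝ → E) (β a b : ℝ) (W : Type*) [NormedAddCommGroup W]
    [NormedSpace ℝ W] : Submodule ℝ (PathPair E W a b) where
  carrier := {x | BddAbove (range fun t => ‖x.1 t‖) ∧ BddAbove (range fun t => ‖x.2 t‖) ∧
    BddAbove (range fun p => derivQuot β p x) ∧ BddAbove (range fun p => remQuot X β p x)}
  add_mem' := by
    rintro x y ⟨h1, h2, h3, h4⟩ ⟨k1, k2, k3, k4⟩
    exact ⟨ctrl_bdd_add (q := fun t (x : PathPair E W a b) => ‖x.1 t‖)
        (fun t x y => norm_add_le _ _) h1 k1,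
      ctrl_bdd_add (q := fun t (x : PathPair E W a b) => ‖x.2 t‖)
        (fun t x y => norm_add_le _ _) h2 k2,
      ctrl_bdd_add (derivQuot_add β) h3 k3, ctrl_bdd_add (remQuot_add X β) h4 k4⟩
  zero_mem' := by
    refine ⟨⟨0, ?_⟩, ⟨0, ?_⟩, ⟨0, ?_⟩, ⟨0, ?_⟩⟩ <;> rintro _ ⟨i, rfl⟩ <;>
      simp [derivQuot, remQuot, ctrlRemainder]
  smul_mem' := by
    rintro c x ⟨h1, h2, h3, h4⟩
    exact ⟨ctrl_bdd_smul (q := fun t (x : PathPair E W a b) => ‖x.1 t‖)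
        (fun t c x => norm_smul c _) c h1,
      ctrl_bdd_smul (q := fun t (x : PathPair E W a b) => ‖x.2 t‖)
        (fun t c x => norm_smul c _) c h2,
      ctrl_bdd_smul (derivQuot_smul β) c h3, ctrl_bdd_smul (remQuot_smul X β) c h4⟩

/-- `‖(m, m')‖ = ‖m‖_∞ + ‖m'‖_∞ + ‖m'‖_β + ‖m^#‖_{2β}`. -/
noncomputable def ctrlNorm {a b : ℝ} (X : ℝ → E) (β : ℝ) (x : PathPair E W a b) : ℝ :=
  (⨆ t, ‖x.1 t‖) + (⨆ t, ‖x.2 t‖) + (⨆ p, derivQuot β p x) + ⨆ p, remQuot X β p x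

theorem ctrlNorm_nonneg {a b : ℝ} (X : ℝ → E) (β : ℝ) (x : PathPair E W a b) :
    0 ≤ ctrlNorm X β x :=
  add_nonneg (add_nonneg (add_nonneg (Real.iSup_nonneg fun _ => norm_nonneg _)
    (Real.iSup_nonneg fun _ => norm_nonneg _)) (Real.iSup_nonneg fun p => derivQuot_nonneg β p x))
    (Real.iSup_nonneg fun p => remQuot_nonneg X β p x)

theorem ctrlNorm_smul {a b : ℝ} (X : ℝ → E) (β c : ℝ) (x : PathPair E W a b) :
    ctrlNorm X β (c • x) = |c| * ctrlNorm X β x := by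
  have h1 : (⨆ t, ‖(c • x).1 t‖) = |c| * ⨆ t, ‖x.1 t‖ :=
    ctrl_sup_smul (q := fun t (x : PathPair E W a b) => ‖x.1 t‖) (fun t c x => norm_smul c _) c x
  have h2 : (⨆ t, ‖(c • x).2 t‖) = |c| * ⨆ t, ‖x.2 t‖ :=
    ctrl_sup_smul (q := fun t (x : PathPair E W a b) => ‖x.2 t‖) (fun t c x => norm_smul c _) c x
  have h3 := ctrl_sup_smul (derivQuot_smul β) c x
  have h4 := ctrl_sup_smul (remQuot_smul X β) c x
  unfold ctrlNorm
  rw [h1, h2, h3, h4]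
  ring

theorem ctrlNorm_add {a b : ℝ} (X : ℝ → E) (β : ℝ) {x y : PathPair E W a b}
    (hx : x ∈ controlledSubmodule X β a b W) (hy : y ∈ controlledSubmodule X β a b W) :
    ctrlNorm X β (x + y) ≤ ctrlNorm X β x + ctrlNorm X β y := by
  obtain ⟨h1, h2, h3, h4⟩ := hx
  obtain ⟨k1, k2, k3, k4⟩ := hy
  have l1 : (⨆ t, ‖(x + y).1 t‖) ≤ (⨆ t, ‖x.1 t‖) + ⨆ t, ‖y.1 t‖ :=
    ctrl_sup_add (q := fun t (x : PathPair E W a b) => ‖x.1 t‖)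
      (fun _ _ => norm_nonneg _) (fun t x y => norm_add_le _ _) h1 k1
  have l2 : (⨆ t, ‖(x + y).2 t‖) ≤ (⨆ t, ‖x.2 t‖) + ⨆ t, ‖y.2 t‖ :=
    ctrl_sup_add (q := fun t (x : PathPair E W a b) => ‖x.2 t‖)
      (fun _ _ => norm_nonneg _) (fun t x y => norm_add_le _ _) h2 k2
  have l3 : (⨆ p, derivQuot β p (x + y)) ≤ (⨆ p, derivQuot β p x) + ⨆ p, derivQuot β p y :=
    ctrl_sup_add (q := fun p (x : PathPair E W a b) => derivQuot β p x)
      (fun p x => derivQuot_nonneg β p x) (fun p x y => derivQuot_add β p x y) h3 k3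
  have l4 : (⨆ p, remQuot X β p (x + y)) ≤ (⨆ p, remQuot X β p x) + ⨆ p, remQuot X β p y :=
    ctrl_sup_add (q := fun p (x : PathPair E W a b) => remQuot X β p x)
      (fun p x => remQuot_nonneg X β p x) (fun p x y => remQuot_add X β p x y) h4 k4
  have key := add_le_add (add_le_add (add_le_add l1 l2) l3) l4
  unfold ctrlNorm
  refine key.trans (le_of_eq ?_)
  ring

theorem ctrlNorm_eq_zero {a b : ℝ} (X : ℝ → E) (β : ℝ) {x : PathPair E W a b}
    (hx : x ∈ controlledSubmodule X β a b W) (h : ctrlNorm X β x = 0) : x = 0 := by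
  have h1 : 0 ≤ ⨆ t, ‖x.1 t‖ := Real.iSup_nonneg fun _ => norm_nonneg _
  have h2 : 0 ≤ ⨆ t, ‖x.2 t‖ := Real.iSup_nonneg fun _ => norm_nonneg _
  have h3 : 0 ≤ ⨆ p, derivQuot β p x := Real.iSup_nonneg fun _ => derivQuot_nonneg _ _ _
  have h4 : 0 ≤ ⨆ p, remQuot X β p x := Real.iSup_nonneg fun _ => remQuot_nonneg _ _ _ _
  unfold ctrlNorm at h
  have e1 : (⨆ t, ‖x.1 t‖) = 0 := by linarith
  have e2 : (⨆ t, ‖x.2 t‖) = 0 := by linarith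
  obtain ⟨b1, b2, -, -⟩ := hx
  refine Prod.ext (funext fun t => ?_) (funext fun t => ?_)
  · exact norm_le_zero_iff.1 ((le_ciSup b1 t).trans e1.le)
  · exact norm_le_zero_iff.1 ((le_ciSup b2 t).trans e2.le)

/-- The space `𝒟^β_X([a, b], W)` of paths controlled by `X`, as pairs `(m, m')` of a path and its
Gubinelli derivative. -/
def ControlledPath (X : ℝ → E) (β a b : ℝ) (W : Type*) [NormedAddCommGroup W]
    [NormedSpace ℝ W] : Type _ :=
  ↥(controlledSubmodule X β a b W)

namespace ControlledPath

variable {X : ℝ → E} {β a b : ℝ}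

instance instAddCommGroup : AddCommGroup (ControlledPath X β a b W) :=
  inferInstanceAs (AddCommGroup ↥(controlledSubmodule X β a b W))

instance instModule : Module ℝ (ControlledPath X β a b W) :=
  inferInstanceAs (Module ℝ ↥(controlledSubmodule X β a b W))

/-- The underlying pair `(m, m')`, as a linear map. -/
def toPair : ControlledPath X β a b W →ₗ[ℝ] PathPair E W a b :=
  (controlledSubmodule X β a b W).subtype

/-- The path `m`. -/
def path (x : ControlledPath X β a b W) : Icc a b → W := (toPair x).1

/-- The Gubinelli derivative `m'`. -/
def gubinelli (x : ControlledPath X β a b W) : Icc a b → E →L[ℝ] W := (toPair x).2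

/-- The norm `‖(m, m')‖ = ‖m‖_∞ + ‖m'‖_∞ + ‖m'‖_β + ‖m^#‖_{2β}`. -/
noncomputable instance instNorm : Norm (ControlledPath X β a b W) where
  norm x := ctrlNorm X β (toPair x)

theorem norm_def (x : ControlledPath X β a b W) : ‖x‖ = ctrlNorm X β (toPair x) := rfl

theorem toPair_mem (x : ControlledPath X β a b W) : toPair x ∈ controlledSubmodule X β a b W :=
  x.2

theorem toPair_injective :
    Function.Injective (toPair : ControlledPath X β a b W →ₗ[ℝ] PathPair E W a b) :=
  Subtype.val_injective

theorem normCore : NormedSpace.Core ℝ (ControlledPath X β a b W) where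
  norm_nonneg x := ctrlNorm_nonneg X β _
  norm_smul c x := by
    rw [norm_def, norm_def, map_smul, ctrlNorm_smul, Real.norm_eq_abs]
  norm_triangle x y := by
    rw [norm_def, norm_def, norm_def, map_add]
    exact ctrlNorm_add X β (toPair_mem x) (toPair_mem y)
  norm_eq_zero_iff x := by
    rw [norm_def]
    constructor
    · intro h
      exact toPair_injective ((ctrlNorm_eq_zero X β (toPair_mem x) h).trans (map_zero _).symm)
    · rintro rfl
      rw [map_zero]
      have := ctrlNorm_smul X β 0 (0 : PathPair E W a b)
      simpa using this

noncomputable instance instNormedAddCommGroup : NormedAddCommGroup (ControlledPath X β a b W) :=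
  NormedAddCommGroup.ofCore normCore

noncomputable instance instNormedSpace : NormedSpace ℝ (ControlledPath X β a b W) :=
  NormedSpace.ofCore normCore

end ControlledPath

/-- For `β ≤ γ`: the closure, in `𝒟^β_X([a, b], W)` with its norm, of the subspace
`𝒟^γ_X([a, b], W)`. -/
noncomputable def controlledClosure (X : ℝ → E) (β γ a b : ℝ) (W : Type*) [NormedAddCommGroup W]
    [NormedSpace ℝ W] : Submodule ℝ (ControlledPath X β a b W) :=
  ((controlledSubmodule X γ a b W).comap ControlledPath.toPair).topologicalClosure

/-- `I` is the Young integral of `f` against `X` over `[a, t]`: the limit of all tagged Riemann sums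
`∑ f(ξ_k) (X_{p_{k+1}} - X_{p_k})` as the mesh of the partition `a = p_0 ≤ ⋯ ≤ p_n = t` tends
to `0`. -/
def HasYoungIntegral {a b : ℝ} (f : Icc a b → E →L[ℝ] W) (X : ℝ → E) (t : Icc a b) (I : W) :
    Prop :=
  ∀ ε > 0, ∃ δ > 0, ∀ (n : ℕ) (p ξ : ℕ → Icc a b), Monotone p → (p 0 : ℝ) = a → p n = t →
    (∀ k < n, ξ k ∈ Icc (p k) (p (k + 1)) ∧ (p (k + 1) : ℝ) - p k < δ) →
    ‖(∑ k ∈ Finset.range n, f (ξ k) (X (p (k + 1)) - X (p k))) - I‖ < ε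

/-- `f ∈ C^{0,α}([a, b], W)`: `f` lies in the closure of the smooth functions under the norm
`‖·‖_∞ + ‖·‖_α`. -/
def MemLittleHolder {a b : ℝ} (α : ℝ) (f : Icc a b → W) : Prop :=
  ∀ ε > 0, ∃ F : ℝ → W, ContDiff ℝ ((⊤ : ℕ∞) : WithTop ℕ∞) F ∧ (∀ t : Icc a b, ‖f t - F t‖ ≤ ε) ∧
    ∀ s t : Icc a b, ‖(f t - F t) - (f s - F s)‖ ≤ ε * |(t : ℝ) - s| ^ α

end ControlledPaths

/-! ## Measurable fields of Banach spaces -/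

section Fields

variable {Ω : Type*} [MeasurableSpace Ω] (E : Ω → Type*) [∀ ω, NormedAddCommGroup (E ω)]
  [∀ ω, NormedSpace ℝ (E ω)]

/-- The linear subspace `Δ` of `∏ ω, E ω` witnesses that `E` is a measurable field. -/
structure IsMeasurableSections (Δ : Submodule ℝ (∀ ω, E ω)) : Prop where
  exists_countable_dense : ∃ Δ₀ : Set (∀ ω, E ω), Δ₀ ⊆ (Δ : Set (∀ ω, E ω)) ∧ Δ₀.Countable ∧
    ∀ ω, Dense ((fun g : (∀ ω, E ω) => g ω) '' Δ₀)
  measurable_norm : ∀ g ∈ Δ, Measurable fun ω => ‖g ω‖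

/-- `E` is a measurable field of Banach spaces. -/
structure IsMeasurableFieldOfBanachSpaces : Prop where
  complete : ∀ ω, CompleteSpace (E ω)
  exists_sections : ∃ Δ : Submodule ℝ (∀ ω, E ω), IsMeasurableSections E Δ

end Fields

/-! ## Delayed rough paths and fractional Brownian motion -/

/-- A delayed `γ`-rough path `(X, 𝕏, 𝕏(-r))` in `ℝ^d`; `ℝ^d ⊗ ℝ^d` is represented by its
coordinates. -/
structure DelayedRoughPath (d : ℕ) (γ r : ℝ) where
  /-- The path `X`. -/
  X : ℝ → EuclideanSpace ℝ (Fin d)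
  /-- The Lévy area `𝕏`. -/
  area : ℝ → ℝ → Fin d → Fin d → ℝ
  /-- The delayed Lévy area `𝕏(-r)`. -/
  delayedArea : ℝ → ℝ → Fin d → Fin d → ℝ
  holder_X : ∀ a b : ℝ, ∃ C : ℝ, ∀ s ∈ Icc a b, ∀ t ∈ Icc a b, ‖X t - X s‖ ≤ C * |t - s| ^ γ
  continuous_area : Continuous fun p : ℝ × ℝ => area p.1 p.2
  holder_area : ∀ a b : ℝ, ∃ C : ℝ, ∀ s ∈ Icc a b, ∀ t ∈ Icc a b,
    ‖area s t‖ ≤ C * |t - s| ^ (2 * γ)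
  chen_area : ∀ s u t i j,
    area s t i j = area s u i j + area u t i j + (X u - X s) i * (X t - X u) j
  continuous_delayedArea : Continuous fun p : ℝ × ℝ => delayedArea p.1 p.2
  holder_delayedArea : ∀ a b : ℝ, ∃ C : ℝ, ∀ s ∈ Icc a b, ∀ t ∈ Icc a b,
    ‖delayedArea s t‖ ≤ C * |t - s| ^ (2 * γ)
  chen_delayedArea : ∀ s u t, s < u → u < t → ∀ i j,
    delayedArea s t i j =
      delayedArea s u i j + delayedArea u t i j + (X (u - r) - X (s - r)) i * (X t - X u) j

section Probability

variable {Ω : Type*} [MeasurableSpace Ω]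

/-- `(Ω, P, θ)` is an ergodic measurable metric dynamical system with time `ℝ`. -/
structure IsErgodicMetricDynamicalSystem (P : Measure Ω) (θ : ℝ → Ω → Ω) : Prop where
  measurable : Measurable fun p : Ω × ℝ => θ p.2 p.1
  zero : ∀ ω, θ 0 ω = ω
  add : ∀ s t ω, θ (s + t) ω = θ s (θ t ω)
  isProbability : IsProbabilityMeasure P
  invariant : ∀ t, P.map (θ t) = P
  ergodic : ∀ A, MeasurableSet A → (∀ t, θ t ⁻¹' A = A) → P A = 0 ∨ P A = 1

/-- `B` is a delayed `γ`-rough path cocycle over `θ`: a delayed rough path valued process with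
`B_{s,s+t}(ω) = B_{0,t}(θ_s ω)` for the increments of the path and both areas. -/
structure IsDelayedRoughPathCocycle {d : ℕ} {γ r : ℝ} (θ : ℝ → Ω → Ω)
    (B : Ω → DelayedRoughPath d γ r) : Prop where
  measurable_X : ∀ t, Measurable fun ω => (B ω).X t
  measurable_area : ∀ s t, Measurable fun ω => (B ω).area s t
  measurable_delayedArea : ∀ s t, Measurable fun ω => (B ω).delayedArea s t
  cocycle_X : ∀ ω s t, (B ω).X (s + t) - (B ω).X s = (B (θ s ω)).X t - (B (θ s ω)).X 0
  cocycle_area : ∀ ω s t, (B ω).area s (s + t) = (B (θ s ω)).area 0 t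
  cocycle_delayedArea : ∀ ω s t, (B ω).delayedArea s (s + t) = (B (θ s ω)).delayedArea 0 t

/-- `X` is a two-sided `d`-dimensional fractional Brownian motion with Hurst parameter `H`: its
coordinates are independent centred Gaussian processes with covariance
`(|t|^{2H} + |s|^{2H} - |t - s|^{2H}) / 2`. -/
structure IsFractionalBrownianMotion {d : ℕ} (H : ℝ) (P : Measure Ω)
    (X : ℝ → Ω → EuclideanSpace ℝ (Fin d)) : Prop where
  gaussian : ∀ i, IsGaussianProcess (fun t ω => X t ω i) P
  centred : ∀ i t, ∫ ω, X t ω i ∂P = 0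
  covariance : ∀ i s t, ∫ ω, X s ω i * X t ω i ∂P =
    (|t| ^ (2 * H) + |s| ^ (2 * H) - |t - s| ^ (2 * H)) / 2
  independent : iIndepFun (fun i ω (t : ℝ) => X t ω i) P

/-- `I` is the symmetric integral `∫_s^t u d°Y`, that is the limit in `L²(P)`, as `ε ↓ 0`, of
`∫_s^t u_x (Y_{x+ε} - Y_{x-ε}) / (2ε) dx`. -/
def HasSymmetricIntegral (P : Measure Ω) (u Y : ℝ → Ω → ℝ) (s t : ℝ) (I : Ω → ℝ) : Prop :=
  Tendsto (fun ε : ℝ => eLpNorm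
    (fun ω => (∫ x in s..t, u x ω * ((Y (x + ε) ω - Y (x - ε) ω) / (2 * ε))) - I ω) 2 P)
    (𝓝[>] 0) (𝓝 0)

/-- The process `B` is the lift of a fractional Brownian motion with Hurst parameter `H` whose areas
are the symmetric integrals `∫_s^t B_{s,u} ⊗ d°B_u` and `∫_s^t B_{s-r,u-r} ⊗ d°B_u`. -/
structure IsFractionalBrownianLift {d : ℕ} {γ r : ℝ} (H : ℝ) (P : Measure Ω)
    (B : Ω → DelayedRoughPath d γ r) : Prop where
  isFBM : IsFractionalBrownianMotion H P fun t ω => (B ω).X t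
  area : ∀ s t i j, HasSymmetricIntegral P
    (fun u ω => (B ω).X u i - (B ω).X s i) (fun u ω => (B ω).X u j) s t
    (fun ω => (B ω).area s t i j)
  delayedArea : ∀ s t, s ≤ t → ∀ i j, HasSymmetricIntegral P
    (fun u ω => (B ω).X (u - r) i - (B ω).X (s - r) i) (fun u ω => (B ω).X u j) s t
    (fun ω => (B ω).delayedArea s t i j)

/-- The spaces `E_ω`: the closure of `𝒟^γ_{B(ω)}([-r, 0], W)` in `𝒟^β_{B(ω)}([-r, 0], W)`. -/
abbrev ControlledField {d : ℕ} {γ r : ℝ} (B : Ω → DelayedRoughPath d γ r) (β : ℝ) (W : Type*)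
    [NormedAddCommGroup W] [NormedSpace ℝ W] (ω : Ω) : Type _ :=
  ↥(controlledClosure (B ω).X β γ (-r) 0 W)

/-- The section `σ` is `ω ↦ Γ_ω(f, g)`: the path `t ↦ ∫_{-r}^t f dB(ω) + g_t`, with the integral in
the sense of Young, and with Gubinelli derivative `f`. -/
def IsYoungSection {d : ℕ} {γ r : ℝ} (B : Ω → DelayedRoughPath d γ r) (β : ℝ) {W : Type*}
    [NormedAddCommGroup W] [NormedSpace ℝ W]
    (f : Icc (-r) 0 → EuclideanSpace ℝ (Fin d) →L[ℝ] W) (g : Icc (-r) 0 → W)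
    (σ : ∀ ω, ControlledField B β W ω) : Prop :=
  ∀ ω, (σ ω).1.gubinelli = f ∧ ∀ t, HasYoungIntegral f (B ω).X t ((σ ω).1.path t - g t)

end Probability

/-!
The argument is pathwise: completeness, the integrals and density are obtained for each `γ`-Hölder
path `X = B(ω)` separately, and the norms are then measurable because each `X_t` is.

*Young integration.* For `f` of Hölder regularity `1 - ε ≥ 2β` the germ `f_s (X_t - X_s)` is almost
additive up to the exponent `1 - ε + γ > 1`, so that the sewing lemma (`exists_sewing`) gives the
integral together with Young's estimate (`exists_youngIntegral`). By that estimate `Γ(f, g)` is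
bounded by the Hölder norms of `f` and `g` in the controlled norm of any regularity at most half the
Hölder exponent (`exists_ctrlNorm_young_le`). Smooth `f` and `g` give paths of regularity `γ`, as
`2γ ≤ 1`, and hence `Γ(f, g)` lies in the closure `E_ω` for all little Hölder `f` and `g`
(`exists_young_mem_controlledClosure`).

*Density.* Let `(m, m')` be controlled with regularity `γ`. Interpolate `m'` along a grid of mesh `h`
by a smooth function `f`, let `g` be the interpolation of `m - ∫ f dX` along the grid, and consider
`y = ∫ f dX + g`. Then `y = m` and `f = m'` at the grid points, so that the remainders of both agree
there; within a cell the Lipschitz constant `h ^ (γ - 1)` of `f` is compensated by the length of the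
interval. Therefore `(y, f)` is bounded in regularity `γ` uniformly in `h` and uniformly close to
`(m, m')` (`controlled_interp_bounds`), and interpolation of norms gives convergence in the regularity
`β` (`exists_interp_ctrlNorm_le`). For fixed `h` the pair `Γ(f, g)` depends linearly on the finitely
many grid values, so that values from a countable dense set suffice
(`isMeasurableSections_youngSections`).

*Measurability.* Young integrals are limits of Riemann sums, and the suprema in the norm are over
lower semicontinuous functions, hence over countable sets (`measurable_ctrlNorm`).
-/

/-! ### Sewing and Young integration -/

section Sewing

variable {W : Type*} [NormedAddCommGroup W]

/-- The constant of the sewing estimate with exponent `θ > 1`. -/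
noncomputable def sewingConst (θ : ℝ) : ℝ := 2 / (1 - 2 * (1 / 2 : ℝ) ^ θ)

theorem two_mul_half_rpow_lt_one {θ : ℝ} (hθ : 1 < θ) : 2 * (1 / 2 : ℝ) ^ θ < 1 := by
  have h : (1 / 2 : ℝ) ^ θ < (1 / 2 : ℝ) ^ (1 : ℝ) :=
    Real.rpow_lt_rpow_of_exponent_gt (by norm_num) (by norm_num) hθ
  rw [Real.rpow_one] at h
  linarith

theorem sewingConst_nonneg {θ : ℝ} (hθ : 1 < θ) : 0 ≤ sewingConst θ :=
  div_nonneg zero_le_two (by linarith [two_mul_half_rpow_lt_one hθ])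

theorem sewingConst_eq {θ : ℝ} (hθ : 1 < θ) :
    2 * (sewingConst θ * (1 / 2 : ℝ) ^ θ) + 2 = sewingConst θ := by
  have h : (1 - 2 * (1 / 2 : ℝ) ^ θ) ≠ 0 := by linarith [two_mul_half_rpow_lt_one hθ]
  unfold sewingConst
  field_simp
  ring

/-- The maximal inequality behind the sewing lemma: the sums of an almost additive germ along a
partition differ from the germ by a bound that does not depend on the partition. The partition is
split at an interval that contains its midpoint, so that both remaining parts have at most half
the length. -/
theorem norm_sum_germ_sub_le {Ξ : ℝ → ℝ → W} {C θ : ℝ} (hC : 0 ≤ C) (hθ : 1 < θ)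
    (hΞ : ∀ s u t, s ≤ u → u ≤ t → ‖Ξ s t - Ξ s u - Ξ u t‖ ≤ C * (t - s) ^ θ)
    {p : ℕ → ℝ} (hp : Monotone p) (n : ℕ) : ∀ i j, i + n = j →
    ‖(∑ k ∈ Finset.Ico i j, Ξ (p k) (p (k + 1))) - Ξ (p i) (p j)‖
      ≤ sewingConst θ * C * (p j - p i) ^ θ := by
  have hself : ∀ s, Ξ s s = 0 := fun s => by
    have := hΞ s s s le_rfl le_rfl
    rw [sub_self s, Real.zero_rpow (by linarith), mul_zero] at this
    have h0 := norm_le_zero_iff.1 this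
    simpa using h0
  induction n using Nat.strong_induction_on with
  | _ n ih =>
  intro i j hij
  rcases Nat.eq_zero_or_pos n with rfl | hn
  · obtain rfl : i = j := by omega
    simp [hself, Real.zero_rpow (show θ ≠ 0 by linarith)]
  set D := p j - p i with hD
  have hD0 : 0 ≤ D := sub_nonneg.2 (hp (by omega))
  obtain ⟨l, hil, hlj, h1, h2⟩ : ∃ l, i ≤ l ∧ l < j ∧ p l - p i ≤ D / 2 ∧
      p j - p (l + 1) ≤ D / 2 := by
    classical
    have hex : ∃ k, j ≤ i + k + 1 ∨ D / 2 < p (i + k + 1) - p i := ⟨n, Or.inl (by omega)⟩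
    refine ⟨i + Nat.find hex, by omega, ?_, ?_, ?_⟩
    · have := Nat.find_min' hex (m := n - 1) (Or.inl (by omega))
      omega
    · rcases Nat.eq_zero_or_pos (Nat.find hex) with h0 | h0
      · rw [h0]; simp; linarith
      · have := Nat.find_min hex (m := Nat.find hex - 1) (by omega)
        push Not at this
        have h3 := this.2
        rwa [show i + (Nat.find hex - 1) + 1 = i + Nat.find hex by omega] at h3
    · rcases Nat.find_spec hex with h | h
      · have := hp h
        linarith
      · linarith
  have hsum : ∑ k ∈ Finset.Ico i j, Ξ (p k) (p (k + 1)) =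
      (∑ k ∈ Finset.Ico i l, Ξ (p k) (p (k + 1))) + (Ξ (p l) (p (l + 1)) +
        ∑ k ∈ Finset.Ico (l + 1) j, Ξ (p k) (p (k + 1))) := by
    rw [← Finset.sum_Ico_consecutive _ hil hlj.le, Finset.sum_eq_sum_Ico_succ_bot hlj]
  have e1 := ih (l - i) (by omega) i l (by omega)
  have e2 := ih (j - (l + 1)) (by omega) (l + 1) j (by omega)
  have hhalf : ∀ x, 0 ≤ x → x ≤ D / 2 → x ^ θ ≤ (1 / 2 : ℝ) ^ θ * D ^ θ := fun x h0 h => by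
    rw [← Real.mul_rpow (by norm_num) hD0]
    exact Real.rpow_le_rpow h0 (by linarith) (by linarith)
  have hKC : 0 ≤ sewingConst θ * C := mul_nonneg (sewingConst_nonneg hθ) hC
  have e1' := e1.trans (mul_le_mul_of_nonneg_left
    (hhalf _ (sub_nonneg.2 (hp hil)) h1) hKC)
  have e2' := e2.trans (mul_le_mul_of_nonneg_left
    (hhalf _ (sub_nonneg.2 (hp hlj)) h2) hKC)
  have e3 := hΞ (p i) (p l) (p j) (hp hil) (hp hlj.le)
  have e4 := hΞ (p l) (p (l + 1)) (p j) (hp (by omega)) (hp hlj)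
  have e4' : C * (p j - p l) ^ θ ≤ C * D ^ θ :=
    mul_le_mul_of_nonneg_left (Real.rpow_le_rpow (sub_nonneg.2 (hp hlj.le))
      (by linarith [hp hil]) (by linarith)) hC
  rw [hsum]
  set S1 := ∑ k ∈ Finset.Ico i l, Ξ (p k) (p (k + 1))
  set S2 := ∑ k ∈ Finset.Ico (l + 1) j, Ξ (p k) (p (k + 1))
  have heq : S1 + (Ξ (p l) (p (l + 1)) + S2) - Ξ (p i) (p j) =
      ((S1 - Ξ (p i) (p l)) + (S2 - Ξ (p (l + 1)) (p j))) -
      ((Ξ (p i) (p j) - Ξ (p i) (p l) - Ξ (p l) (p j)) +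
        (Ξ (p l) (p j) - Ξ (p l) (p (l + 1)) - Ξ (p (l + 1)) (p j))) := by abel
  rw [heq]
  refine (norm_sub_le _ _).trans ?_
  have n1 := norm_add_le (S1 - Ξ (p i) (p l)) (S2 - Ξ (p (l + 1)) (p j))
  have n2 := norm_add_le (Ξ (p i) (p j) - Ξ (p i) (p l) - Ξ (p l) (p j))
    (Ξ (p l) (p j) - Ξ (p l) (p (l + 1)) - Ξ (p (l + 1)) (p j))
  have hK : sewingConst θ * C * D ^ θ =
      2 * (sewingConst θ * C * ((1 / 2 : ℝ) ^ θ * D ^ θ)) + 2 * (C * D ^ θ) := by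
    linear_combination (-(C * D ^ θ)) * sewingConst_eq hθ
  linarith

/-- The sewing lemma. The path is a limit, along an ultrafilter, of the sums of the germ along
the grids of mesh `1 / (n + 1)`; by the maximal inequality any limit point does, so there is no need
to show that the sums converge. -/
theorem exists_sewing [ProperSpace W] {Ξ : ℝ → ℝ → W} {C θ : ℝ} (hC : 0 ≤ C) (hθ : 1 < θ)
    (hcont : Continuous fun q : ℝ × ℝ => Ξ q.1 q.2)
    (hΞ : ∀ s u t, s ≤ u → u ≤ t → ‖Ξ s t - Ξ s u - Ξ u t‖ ≤ C * (t - s) ^ θ) (a : ℝ) :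
    ∃ I : ℝ → W, I a = 0 ∧ ∀ s t, a ≤ s → s ≤ t →
      ‖I t - I s - Ξ s t‖ ≤ sewingConst θ * C * (t - s) ^ θ := by
  set p : ℕ → ℕ → ℝ := fun n k => a + k / (n + 1) with hp
  have hpm : ∀ n, Monotone (p n) := fun n i j hij => by
    simp only [hp]
    gcongr
  set ind : ℕ → ℝ → ℕ := fun n t => ⌊(t - a) * ((n : ℝ) + 1)⌋₊ with hind
  set S : ℕ → ℝ → W := fun n t => ∑ k ∈ Finset.Ico 0 (ind n t), Ξ (p n k) (p n (k + 1)) with hS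
  have hlim : ∀ t, a ≤ t → Tendsto (fun n => p n (ind n t)) atTop (𝓝 t) := fun t ht => by
    have h0 : Tendsto (fun n : ℕ => t - 1 / ((n : ℝ) + 1)) atTop (𝓝 t) := by
      simpa using tendsto_const_nhds.sub (tendsto_one_div_add_atTop_nhds_zero_nat (𝕜 := ℝ))
    refine tendsto_of_tendsto_of_tendsto_of_le_of_le h0 tendsto_const_nhds (fun n => ?_) fun n => ?_
    · have hn : (0 : ℝ) < (n : ℝ) + 1 := by positivity
      have := (Nat.lt_floor_add_one ((t - a) * ((n : ℝ) + 1))).le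
      simp only [hp, hind]
      rw [sub_le_iff_le_add, add_assoc, ← add_div, ← sub_le_iff_le_add', le_div_iff₀ hn]
      exact this
    · have hn : (0 : ℝ) < (n : ℝ) + 1 := by positivity
      have := Nat.floor_le (mul_nonneg (sub_nonneg.2 ht) hn.le)
      simp only [hp, hind]
      rw [← le_sub_iff_add_le', div_le_iff₀ hn]
      exact this
  have hest : ∀ n s t, s ≤ t → ‖S n t - S n s - Ξ (p n (ind n s)) (p n (ind n t))‖ ≤
      sewingConst θ * C * (p n (ind n t) - p n (ind n s)) ^ θ := fun n s t hst => by
    have hle : ind n s ≤ ind n t := Nat.floor_mono (by gcongr)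
    have := norm_sum_germ_sub_le hC hθ hΞ (hpm n) (ind n t - ind n s) (ind n s) (ind n t) (by omega)
    have hS' : S n t - S n s = ∑ k ∈ Finset.Ico (ind n s) (ind n t), Ξ (p n k) (p n (k + 1)) := by
      simp only [hS]
      rw [← Finset.sum_Ico_consecutive _ (Nat.zero_le _) hle, add_sub_cancel_left]
    rwa [hS']
  have hΞlim : ∀ s t, a ≤ s → a ≤ t → Tendsto (fun n => Ξ (p n (ind n s)) (p n (ind n t))) atTop
      (𝓝 (Ξ s t)) := fun s t hs ht =>
    (hcont.tendsto (s, t)).comp ((hlim s hs).prodMk_nhds (hlim t ht))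
  have hrlim : ∀ s t, a ≤ s → a ≤ t → Tendsto (fun n => sewingConst θ * C *
      (p n (ind n t) - p n (ind n s)) ^ θ) atTop (𝓝 (sewingConst θ * C * (t - s) ^ θ)) :=
    fun s t hs ht => (((hlim t ht).sub (hlim s hs)).rpow_const (Or.inr (by linarith))).const_mul _
  have hSa : ∀ n, S n a = 0 := fun n => by simp [hS, hind]
  have hex : ∀ t, ∃ x, a ≤ t → Tendsto (fun n => S n t) (hyperfilter ℕ : Filter ℕ) (𝓝 x) := by
    intro t
    by_cases ht : a ≤ t
    · obtain ⟨R1, h1⟩ := (hΞlim a t le_rfl ht).norm.bddAbove_range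
      obtain ⟨R2, h2⟩ := (hrlim a t le_rfl ht).bddAbove_range
      have hb : ∀ n, S n t ∈ Metric.closedBall (0 : W) (R1 + R2) := fun n => by
        have k1 := hest n a t ht
        have k2 := h1 ⟨n, rfl⟩
        have k3 := h2 ⟨n, rfl⟩
        rw [hSa, sub_zero] at k1
        have := norm_le_insert' (S n t) (Ξ (p n (ind n a)) (p n (ind n t)))
        rw [mem_closedBall_zero_iff]
        simp only at k2 k3
        linarith
      obtain ⟨x, -, hx⟩ := (isCompact_closedBall (0 : W) (R1 + R2)).ultrafilter_le_nhds
        ((hyperfilter ℕ).map fun n => S n t) (by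
          rw [le_principal_iff]
          exact Ultrafilter.mem_map.2 (Filter.univ_mem' hb))
      exact ⟨x, fun _ => hx⟩
    · exact ⟨0, fun h => absurd h ht⟩
  choose I hI using hex
  have hle : (hyperfilter ℕ : Filter ℕ) ≤ atTop := by
    rw [← Nat.cofinite_eq_atTop]; exact hyperfilter_le_cofinite
  refine ⟨I, ?_, fun s t hs hst => ?_⟩
  · refine tendsto_nhds_unique (hI a le_rfl) ?_
    simp only [hSa]
    exact tendsto_const_nhds
  · refine le_of_tendsto_of_tendsto
      (((hI t (hs.trans hst)).sub (hI s hs)).sub ((hΞlim s t hs (hs.trans hst)).mono_left hle)).norm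
      ((hrlim s t hs (hs.trans hst)).mono_left hle) (Filter.Eventually.of_forall fun n => ?_)
    exact hest n s t hst

end Sewing

section Young

theorem continuous_of_norm_sub_le_rpow {T V : Type*} [PseudoMetricSpace T]
    [SeminormedAddCommGroup V] {f : T → V} {A α : ℝ} (hα : 0 < α)
    (hf : ∀ s t, ‖f t - f s‖ ≤ A * dist t s ^ α) : Continuous f := by
  refine continuous_iff_continuousAt.2 fun s => tendsto_iff_norm_sub_tendsto_zero.2 ?_
  refine squeeze_zero (fun _ => norm_nonneg _) (fun t => hf s t) ?_
  have h : Tendsto (fun t => dist t s) (𝓝 s) (𝓝 0) := by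
    simpa using (continuous_id.dist (continuous_const (y := s))).tendsto s
  simpa [Real.zero_rpow hα.ne'] using (h.rpow_const (p := α) (Or.inr hα.le)).const_mul A

variable {E W : Type*} [NormedAddCommGroup E] [NormedSpace ℝ E]
  [NormedAddCommGroup W] [NormedSpace ℝ W] {a b : ℝ}

theorem HasYoungIntegral.add {f g : Icc a b → E →L[ℝ] W} {X : ℝ → E} {t : Icc a b} {I J : W}
    (hf : HasYoungIntegral f X t I) (hg : HasYoungIntegral g X t J) :
    HasYoungIntegral (f + g) X t (I + J) := by
  intro ε hε
  obtain ⟨δ₁, h1, H1⟩ := hf (ε / 2) (by positivity)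
  obtain ⟨δ₂, h2, H2⟩ := hg (ε / 2) (by positivity)
  refine ⟨min δ₁ δ₂, lt_min h1 h2, fun n p ξ hp h0 hn hm => ?_⟩
  have k1 := H1 n p ξ hp h0 hn fun k hk => ⟨(hm k hk).1, (hm k hk).2.trans_le (min_le_left _ _)⟩
  have k2 := H2 n p ξ hp h0 hn fun k hk => ⟨(hm k hk).1, (hm k hk).2.trans_le (min_le_right _ _)⟩
  simp only [Pi.add_apply, _root_.add_apply, Finset.sum_add_distrib]
  rw [add_sub_add_comm]
  exact (norm_add_le _ _).trans_lt (by linarith)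

theorem HasYoungIntegral.const_smul {f : Icc a b → E →L[ℝ] W} {X : ℝ → E} {t : Icc a b} {I : W}
    (hf : HasYoungIntegral f X t I) (c : ℝ) : HasYoungIntegral (c • f) X t (c • I) := by
  intro ε hε
  obtain ⟨δ, h, H⟩ := hf (ε / (|c| + 1)) (by positivity)
  refine ⟨δ, h, fun n p ξ hp h0 hn hm => ?_⟩
  have k := H n p ξ hp h0 hn hm
  simp only [Pi.smul_apply, _root_.smul_apply, ← Finset.smul_sum]
  rw [← smul_sub, norm_smul, Real.norm_eq_abs]
  rw [lt_div_iff₀ (by positivity)] at k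
  nlinarith [norm_nonneg ((∑ k ∈ Finset.range n, f (ξ k) (X (p (k + 1)) - X (p k))) - I)]

theorem exists_partition (t : Icc a b) {δ : ℝ} (hδ : 0 < δ) :
    ∃ (n : ℕ) (p : ℕ → Icc a b), Monotone p ∧ (p 0 : ℝ) = a ∧ p n = t ∧
      ∀ k, (p (k + 1) : ℝ) - p k < δ := by
  have hmem : ∀ k : ℕ, min (a + k * (δ / 2)) t ∈ Icc a b := fun k =>
    ⟨le_min (by have : 0 ≤ k * (δ / 2) := by positivity
                linarith) t.2.1, (min_le_right _ _).trans t.2.2⟩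
  obtain ⟨n, hn⟩ := exists_nat_ge (((t : ℝ) - a) / (δ / 2))
  rw [div_le_iff₀ (by positivity)] at hn
  refine ⟨n, fun k => ⟨min (a + k * (δ / 2)) t, hmem k⟩, fun i j hij => ?_, ?_, ?_, fun k => ?_⟩
  · exact Subtype.mk_le_mk.2 (min_le_min_right _ (by gcongr))
  · simpa using t.2.1
  · exact Subtype.ext (min_eq_right (by linarith))
  · simp only [Nat.cast_add, Nat.cast_one]
    rcases min_cases (a + (k : ℝ) * (δ / 2)) (t : ℝ) with h | h <;>
    rcases min_cases (a + ((k : ℝ) + 1) * (δ / 2)) (t : ℝ) with h' | h' <;> linarith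

/-- Young integrals over `[a, t]` are limits of Riemann sums along a sequence of partitions that
depends on `t` only. -/
theorem exists_partitions_tendsto_youngIntegral (t : Icc a b) :
    ∃ (N : ℕ → ℕ) (p : ℕ → ℕ → Icc a b), ∀ (f : Icc a b → E →L[ℝ] W) (X : ℝ → E) (I : W),
      HasYoungIntegral f X t I → Tendsto (fun n => ∑ k ∈ Finset.range (N n),
        f (p n k) (X (p n (k + 1)) - X (p n k))) atTop (𝓝 I) := by
  choose N p hp h0 hN hm using fun n : ℕ =>
    exists_partition t (δ := 1 / ((n : ℝ) + 1)) (by positivity)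
  refine ⟨N, p, fun f X I hI => Metric.tendsto_atTop.2 fun ε hε => ?_⟩
  obtain ⟨δ, hδ, H⟩ := hI ε hε
  obtain ⟨n₀, hn₀⟩ := exists_nat_one_div_lt hδ
  refine ⟨n₀, fun n hn => ?_⟩
  rw [dist_eq_norm]
  refine H (N n) (p n) (p n) (hp n) (h0 n) (hN n) fun k _ =>
    ⟨⟨le_rfl, hp n k.le_succ⟩, (hm n k).trans (lt_of_le_of_lt ?_ hn₀)⟩
  exact one_div_le_one_div_of_le (by positivity) (by gcongr)

theorem HasYoungIntegral.unique {f : Icc a b → E →L[ℝ] W} {X : ℝ → E} {t : Icc a b} {I J : W}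
    (hI : HasYoungIntegral f X t I) (hJ : HasYoungIntegral f X t J) : I = J := by
  obtain ⟨N, p, h⟩ := exists_partitions_tendsto_youngIntegral (E := E) (W := W) t
  exact tendsto_nhds_unique (h f X I hI) (h f X J hJ)

/-- The constant of Young's estimate for exponents with sum `θ > 1`. -/
noncomputable def youngConst (θ : ℝ) : ℝ := sewingConst θ + 1

theorem youngConst_nonneg {θ : ℝ} (hθ : 1 < θ) : 0 ≤ youngConst θ :=
  add_nonneg (sewingConst_nonneg hθ) zero_le_one

theorem norm_apply_sub_le_rpow {L : E →L[ℝ] W} {x : E} {A Q r α γ : ℝ} (hr : 0 ≤ r)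
    (h : 1 < α + γ)
    (hL : ‖L‖ ≤ A * r ^ α) (hx : ‖x‖ ≤ Q * r ^ γ) : ‖L x‖ ≤ A * Q * r ^ (α + γ) := by
  refine (L.le_of_opNorm_le_of_le hL hx).trans (le_of_eq ?_)
  rw [Real.rpow_add' hr (by linarith)]
  ring

/-- A path whose increments are compensated Riemann summands up to a power larger than `1` is a
Young integral. -/
theorem hasYoungIntegral_of_norm_sub_le {f : Icc a b → E →L[ℝ] W} {X : ℝ → E} {I : Icc a b → W}
    {M θ : ℝ} (hM : 0 ≤ M) (hθ : 1 < θ)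
    (hI0 : ∀ t : Icc a b, (t : ℝ) = a → I t = 0)
    (hI : ∀ s ξ t : Icc a b, s ≤ ξ → ξ ≤ t →
      ‖f ξ (X t - X s) - (I t - I s)‖ ≤ M * ((t : ℝ) - s) ^ θ) (t : Icc a b) :
    HasYoungIntegral f X t (I t) := by
  intro ε hε
  obtain ⟨δ, hδ, hδε⟩ : ∃ δ : ℝ, 0 < δ ∧ M * δ ^ (θ - 1) * (t - a) < ε := by
    have h1 : Tendsto (fun δ : ℝ => M * δ ^ (θ - 1) * (t - a)) (𝓝[>] 0) (𝓝 0) := by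
      have h2 : Tendsto (fun δ : ℝ => δ ^ (θ - 1)) (𝓝[>] 0) (𝓝 0) := by
        have := (tendsto_id (x := 𝓝 (0 : ℝ))).rpow_const (p := θ - 1) (Or.inr (by linarith))
        rw [Real.zero_rpow (by linarith)] at this
        exact this.mono_left nhdsWithin_le_nhds
      simpa using (h2.const_mul M).mul_const ((t : ℝ) - a)
    obtain ⟨δ, h, h'⟩ := ((h1.eventually (gt_mem_nhds hε)).and self_mem_nhdsWithin).exists
    exact ⟨δ, h', h⟩
  refine ⟨δ, hδ, fun n p ξ hp h0 hn hm => ?_⟩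
  have hIt : I t = ∑ k ∈ Finset.range n, (I (p (k + 1)) - I (p k)) := by
    rw [Finset.sum_range_sub (fun k => I (p k)), hn, hI0 _ h0, sub_zero]
  have hta : (t : ℝ) - a = ∑ k ∈ Finset.range n, ((p (k + 1) : ℝ) - p k) := by
    rw [Finset.sum_range_sub (fun k => (p k : ℝ)), hn, h0]
  rw [hIt, ← Finset.sum_sub_distrib]
  refine lt_of_le_of_lt ((norm_sum_le _ _).trans ?_) hδε
  rw [hta, Finset.mul_sum]
  refine Finset.sum_le_sum fun k hk => ?_
  obtain ⟨h1, h2⟩ := hm k (Finset.mem_range.1 hk)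
  refine (hI _ _ _ h1.1 h1.2).trans ?_
  have hd : 0 ≤ (p (k + 1) : ℝ) - p k := sub_nonneg.2 (hp k.le_succ)
  have : ((p (k + 1) : ℝ) - p k) ^ θ =
      ((p (k + 1) : ℝ) - p k) ^ (θ - 1) * ((p (k + 1) : ℝ) - p k) := by
    rw [← Real.rpow_add_one' hd (by linarith)]
    ring_nf
  rw [this, mul_assoc]
  gcongr

/-- Young's theorem: existence of the integral, and Young's estimate. -/
theorem exists_youngIntegral [ProperSpace W] (hab : a ≤ b) {f : Icc a b → E →L[ℝ] W} {X : ℝ → E}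
    {A Q α γ : ℝ} (hA : 0 ≤ A) (hQ : 0 ≤ Q) (hα : 0 < α) (hγ : 0 < γ) (hαγ : 1 < α + γ)
    (hf : ∀ s t : Icc a b, ‖f t - f s‖ ≤ A * |(t : ℝ) - s| ^ α)
    (hX : ∀ s t : Icc a b, ‖X t - X s‖ ≤ Q * |(t : ℝ) - s| ^ γ) :
    ∃ I : Icc a b → W, (∀ t, HasYoungIntegral f X t (I t)) ∧ (∀ t : Icc a b, (t : ℝ) = a → I t = 0) ∧
      ∀ s t, ‖I t - I s - f s (X t - X s)‖ ≤
        youngConst (α + γ) * (A * Q) * |(t : ℝ) - s| ^ (α + γ) := by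
  -- Continuing `f` and `X` by their boundary values preserves their Hölder constants.
  set π : ℝ → Icc a b := projIcc a b hab with hπ
  have hπl : ∀ s t : ℝ, |(π t : ℝ) - π s| ≤ |t - s| := fun s t => abs_projIcc_sub_projIcc hab
  have hπe : ∀ t : Icc a b, π t = t := projIcc_val hab
  have hf' : ∀ s t : ℝ, ‖f (π t) - f (π s)‖ ≤ A * |t - s| ^ α := fun s t =>
    (hf _ _).trans
      (mul_le_mul_of_nonneg_left (Real.rpow_le_rpow (abs_nonneg _) (hπl s t) hα.le) hA)
  have hX' : ∀ s t : ℝ, ‖X (π t) - X (π s)‖ ≤ Q * |t - s| ^ γ := fun s t =>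
    (hX _ _).trans
      (mul_le_mul_of_nonneg_left (Real.rpow_le_rpow (abs_nonneg _) (hπl s t) hγ.le) hQ)
  have hfc : Continuous fun t => f (π t) := continuous_of_norm_sub_le_rpow hα hf'
  have hXc : Continuous fun t => X (π t) := continuous_of_norm_sub_le_rpow hγ hX'
  have hAQ : 0 ≤ A * Q := mul_nonneg hA hQ
  have hθ0 : 0 ≤ α + γ := by linarith
  obtain ⟨I, hI0, hI⟩ := exists_sewing (Ξ := fun s t => f (π s) (X (π t) - X (π s)))
    (C := A * Q) (θ := α + γ) hAQ hαγ
    ((hfc.comp continuous_fst).clm_apply ((hXc.comp continuous_snd).sub (hXc.comp continuous_fst)))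
    (fun s u t hsu hut => by
      have : f (π s) (X (π t) - X (π s)) - f (π s) (X (π u) - X (π s)) - f (π u) (X (π t) - X (π u))
          = -((f (π u) - f (π s)) (X (π t) - X (π u))) := by
        simp only [map_sub, sub_apply]; abel
      rw [this, norm_neg]
      refine norm_apply_sub_le_rpow (by linarith) hαγ ((hf' s u).trans ?_)
        ((hX' u t).trans ?_)
      · rw [abs_of_nonneg (by linarith)]; gcongr
      · rw [abs_of_nonneg (by linarith)]; gcongr) a
  have hK : 0 ≤ sewingConst (α + γ) * (A * Q) := mul_nonneg (sewingConst_nonneg hαγ) hAQ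
  have hI1 : ∀ s t : Icc a b, s ≤ t → ‖I t - I s - f s (X t - X s)‖ ≤
      sewingConst (α + γ) * (A * Q) * ((t : ℝ) - s) ^ (α + γ) := fun s t hst => by
    have := hI s t s.2.1 hst
    simpa only [hπe] using this
  -- Moving the evaluation point of `f` costs one more term of the same order.
  have hmove : ∀ s ξ t : Icc a b, s ≤ ξ → ξ ≤ t → ‖(f ξ - f s) (X t - X s)‖ ≤
      A * Q * ((t : ℝ) - s) ^ (α + γ) := fun s ξ t h1 h2 => by
    have h1' : (s : ℝ) ≤ ξ := h1
    have h2' : (ξ : ℝ) ≤ t := h2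
    refine norm_apply_sub_le_rpow (by linarith) hαγ ((hf s ξ).trans ?_) ((hX s t).trans ?_)
    · rw [abs_of_nonneg (by linarith)]; gcongr
    · rw [abs_of_nonneg (by linarith)]
  have hI2 : ∀ s ξ t : Icc a b, s ≤ ξ → ξ ≤ t → ‖f ξ (X t - X s) - (I t - I s)‖ ≤
      youngConst (α + γ) * (A * Q) * ((t : ℝ) - s) ^ (α + γ) := fun s ξ t h1 h2 => by
    have heq : f ξ (X t - X s) - (I t - I s) =
        (f ξ - f s) (X t - X s) - (I t - I s - f s (X t - X s)) := by
      simp only [sub_apply]; abel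
    rw [heq, youngConst, add_mul, add_mul, one_mul, add_comm]
    exact (norm_sub_le _ _).trans (add_le_add (hmove s ξ t h1 h2) (hI1 s t (h1.trans h2)))
  refine ⟨fun t => I t, fun t => hasYoungIntegral_of_norm_sub_le
    (mul_nonneg (youngConst_nonneg hαγ) hAQ) hαγ (fun t ht => by rw [ht, hI0]) hI2 t,
    fun t ht => (congrArg I ht).trans hI0,
    fun s t => ?_⟩
  rcases le_total s t with hst | hst
  · have hst' : (s : ℝ) ≤ t := hst
    rw [← norm_neg, neg_sub, abs_of_nonneg (by linarith)]
    exact hI2 s s t le_rfl hst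
  · have hst' : (t : ℝ) ≤ s := hst
    have heq : I t - I s - f s (X t - X s) = f s (X s - X t) - (I s - I t) := by
      simp only [map_sub]; abel
    rw [heq, abs_of_nonpos (by linarith), neg_sub]
    exact hI2 t s s hst le_rfl

end Young

/-! ### Spaces of controlled paths -/

section Controlled

variable {E W : Type*} [NormedAddCommGroup E] [NormedSpace ℝ E]
  [NormedAddCommGroup W] [NormedSpace ℝ W] {a b β γ : ℝ} {X : ℝ → E}

theorem ctrlRemainder_self (x : PathPair E W a b) (s : Icc a b) : ctrlRemainder X x s s = 0 := by
  simp [ctrlRemainder]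

theorem ctrlRemainder_sub (x y : PathPair E W a b) (s t : Icc a b) :
    ctrlRemainder X (x - y) s t = ctrlRemainder X x s t - ctrlRemainder X y s t := by
  simp only [ctrlRemainder, Prod.fst_sub, Prod.snd_sub, Pi.sub_apply, _root_.sub_apply]
  abel

theorem ctrlNorm_le {x : PathPair E W a b} {M₁ M₂ M₃ M₄ : ℝ} (h₁ : 0 ≤ M₁) (h₂ : 0 ≤ M₂)
    (h₃ : 0 ≤ M₃) (h₄ : 0 ≤ M₄) (hx₁ : ∀ t, ‖x.1 t‖ ≤ M₁) (hx₂ : ∀ t, ‖x.2 t‖ ≤ M₂)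
    (hx₃ : ∀ s t : Icc a b, ‖x.2 t - x.2 s‖ ≤ M₃ * |(t : ℝ) - s| ^ β)
    (hx₄ : ∀ s t : Icc a b, ‖ctrlRemainder X x s t‖ ≤ M₄ * |(t : ℝ) - s| ^ (2 * β)) :
    x ∈ controlledSubmodule X β a b W ∧ ctrlNorm X β x ≤ M₁ + M₂ + M₃ + M₄ := by
  have k₃ : ∀ p, derivQuot β p x ≤ M₃ := fun p =>
    div_le_of_le_mul₀ (by positivity) h₃ (hx₃ _ _)
  have k₄ : ∀ p, remQuot X β p x ≤ M₄ := fun p =>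
    div_le_of_le_mul₀ (by positivity) h₄ (hx₄ _ _)
  refine ⟨⟨⟨M₁, ?_⟩, ⟨M₂, ?_⟩, ⟨M₃, ?_⟩, ⟨M₄, ?_⟩⟩, ?_⟩
  · rintro _ ⟨t, rfl⟩; exact hx₁ t
  · rintro _ ⟨t, rfl⟩; exact hx₂ t
  · rintro _ ⟨p, rfl⟩; exact k₃ p
  · rintro _ ⟨p, rfl⟩; exact k₄ p
  · exact add_le_add (add_le_add (add_le_add (Real.iSup_le hx₁ h₁) (Real.iSup_le hx₂ h₂))
      (Real.iSup_le k₃ h₃)) (Real.iSup_le k₄ h₄)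

theorem ctrlNorm_bounds {x : PathPair E W a b} (hx : x ∈ controlledSubmodule X β a b W) :
    (∀ t, ‖x.1 t‖ ≤ ctrlNorm X β x) ∧ (∀ t, ‖x.2 t‖ ≤ ctrlNorm X β x) ∧
    (∀ s t : Icc a b, ‖x.2 t - x.2 s‖ ≤ ctrlNorm X β x * |(t : ℝ) - s| ^ β) ∧
    ∀ s t : Icc a b, ‖ctrlRemainder X x s t‖ ≤ ctrlNorm X β x * |(t : ℝ) - s| ^ (2 * β) := by
  obtain ⟨b₁, b₂, b₃, b₄⟩ := hx
  have h₁ : 0 ≤ ⨆ t, ‖x.1 t‖ := Real.iSup_nonneg fun _ => norm_nonneg _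
  have h₂ : 0 ≤ ⨆ t, ‖x.2 t‖ := Real.iSup_nonneg fun _ => norm_nonneg _
  have h₃ : 0 ≤ ⨆ p, derivQuot β p x := Real.iSup_nonneg fun _ => derivQuot_nonneg _ _ _
  have h₄ : 0 ≤ ⨆ p, remQuot X β p x := Real.iSup_nonneg fun _ => remQuot_nonneg _ _ _ _
  refine ⟨fun t => ?_, fun t => ?_, fun s t => ?_, fun s t => ?_⟩
  · have := le_ciSup b₁ t
    unfold ctrlNorm; linarith
  · have := le_ciSup b₂ t
    unfold ctrlNorm; linarith
  · rcases eq_or_ne s t with rfl | hst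
    · rw [sub_self, norm_zero]
      exact mul_nonneg (ctrlNorm_nonneg X β x) (by positivity)
    · have := le_ciSup b₃ (s, t)
      have hpos : 0 < |(t : ℝ) - s| := abs_pos.2 (sub_ne_zero.2 fun h => hst (Subtype.ext h.symm))
      rw [← div_le_iff₀ (by positivity)]
      simp only [derivQuot] at this h₃
      unfold ctrlNorm; simp only [derivQuot]; linarith
  · rcases eq_or_ne s t with rfl | hst
    · rw [ctrlRemainder_self, norm_zero]
      exact mul_nonneg (ctrlNorm_nonneg X β x) (by positivity)
    · have := le_ciSup b₄ (s, t)
      have hpos : 0 < |(t : ℝ) - s| := abs_pos.2 (sub_ne_zero.2 fun h => hst (Subtype.ext h.symm))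
      rw [← div_le_iff₀ (by positivity)]
      simp only [remQuot] at this h₄
      unfold ctrlNorm; simp only [remQuot]; linarith

theorem tendsto_ctrlRemainder {ι : Type*} {l : Filter ι} {x : ι → PathPair E W a b}
    {y : PathPair E W a b} (h₁ : ∀ t, Tendsto (fun n => (x n).1 t) l (𝓝 (y.1 t)))
    (h₂ : ∀ t, Tendsto (fun n => (x n).2 t) l (𝓝 (y.2 t))) (s t : Icc a b) :
    Tendsto (fun n => ctrlRemainder X (x n) s t) l (𝓝 (ctrlRemainder X y s t)) :=
  ((h₁ t).sub (h₁ s)).sub (((ContinuousLinearMap.apply ℝ W (X t - X s)).continuous.tendsto _).comp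
    (h₂ s))

/-- The controlled path with a given underlying pair. -/
def ControlledPath.mk (x : PathPair E W a b) (hx : x ∈ controlledSubmodule X β a b W) :
    ControlledPath X β a b W := ⟨x, hx⟩

theorem ControlledPath.toPair_mk (x : PathPair E W a b) (hx : x ∈ controlledSubmodule X β a b W) :
    ControlledPath.toPair (ControlledPath.mk x hx) = x := rfl

theorem ControlledPath.dist_def (x y : ControlledPath X β a b W) :
    dist x y = ctrlNorm X β (ControlledPath.toPair x - ControlledPath.toPair y) := by
  rw [dist_eq_norm, ControlledPath.norm_def, map_sub]

instance ControlledPath.instCompleteSpace [CompleteSpace W] :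
    CompleteSpace (ControlledPath X β a b W) := by
  refine Metric.complete_of_cauchySeq_tendsto fun u hu => ?_
  have hN : ∀ ε > 0, ∃ N, ∀ n ≥ N, ∀ k ≥ N,
      ctrlNorm X β (ControlledPath.toPair (u n) - ControlledPath.toPair (u k)) ≤ ε := by
    intro ε hε
    obtain ⟨N, hN⟩ := Metric.cauchySeq_iff.1 hu ε hε
    refine ⟨N, fun n hn k hk => ?_⟩
    have := hN n hn k hk
    rw [ControlledPath.dist_def] at this
    exact this.le
  have hmem : ∀ n k, ControlledPath.toPair (u n) - ControlledPath.toPair (u k) ∈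
      controlledSubmodule X β a b W := fun n k =>
    Submodule.sub_mem _ (ControlledPath.toPair_mem _) (ControlledPath.toPair_mem _)
  have hc₁ : ∀ t, ∃ y, Tendsto (fun n => (ControlledPath.toPair (u n)).1 t) atTop (𝓝 y) :=
    fun t => cauchySeq_tendsto_of_complete (Metric.cauchySeq_iff.2 fun ε hε => by
      obtain ⟨N, h⟩ := hN (ε / 2) (by positivity)
      refine ⟨N, fun n hn k hk => ?_⟩
      rw [dist_eq_norm]
      exact (((ctrlNorm_bounds (hmem n k)).1 t).trans (h n hn k hk)).trans_lt (by linarith))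
  have hc₂ : ∀ t, ∃ y, Tendsto (fun n => (ControlledPath.toPair (u n)).2 t) atTop (𝓝 y) :=
    fun t => cauchySeq_tendsto_of_complete (Metric.cauchySeq_iff.2 fun ε hε => by
      obtain ⟨N, h⟩ := hN (ε / 2) (by positivity)
      refine ⟨N, fun n hn k hk => ?_⟩
      rw [dist_eq_norm]
      exact (((ctrlNorm_bounds (hmem n k)).2.1 t).trans (h n hn k hk)).trans_lt (by linarith))
  choose m hm using hc₁
  choose m' hm' using hc₂
  have key : ∀ ε > 0, ∃ N, ∀ n ≥ N,
      ControlledPath.toPair (u n) - (m, m') ∈ controlledSubmodule X β a b W ∧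
      ctrlNorm X β (ControlledPath.toPair (u n) - (m, m')) ≤ ε + ε + ε + ε := by
    intro ε hε
    obtain ⟨N, h⟩ := hN ε hε
    refine ⟨N, fun n hn => ?_⟩
    have l₁ : ∀ t, Tendsto (fun k => (ControlledPath.toPair (u n) - ControlledPath.toPair (u k)).1 t)
        atTop (𝓝 ((ControlledPath.toPair (u n) - (m, m')).1 t)) :=
      fun t => tendsto_const_nhds.sub (hm t)
    have l₂ : ∀ t, Tendsto (fun k => (ControlledPath.toPair (u n) - ControlledPath.toPair (u k)).2 t)
        atTop (𝓝 ((ControlledPath.toPair (u n) - (m, m')).2 t)) :=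
      fun t => tendsto_const_nhds.sub (hm' t)
    have hev : ∀ᶠ k in atTop, N ≤ k := eventually_ge_atTop N
    refine ctrlNorm_le hε.le hε.le hε.le hε.le (fun t => ?_) (fun t => ?_) (fun s t => ?_)
      fun s t => ?_
    · refine le_of_tendsto (l₁ t).norm (hev.mono fun k hk => ?_)
      exact ((ctrlNorm_bounds (hmem n k)).1 t).trans (h n hn k hk)
    · refine le_of_tendsto (l₂ t).norm (hev.mono fun k hk => ?_)
      exact ((ctrlNorm_bounds (hmem n k)).2.1 t).trans (h n hn k hk)
    · refine le_of_tendsto ((l₂ t).sub (l₂ s)).norm (hev.mono fun k hk => ?_)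
      exact ((ctrlNorm_bounds (hmem n k)).2.2.1 s t).trans (by gcongr; exact h n hn k hk)
    · refine le_of_tendsto (tendsto_ctrlRemainder l₁ l₂ s t).norm (hev.mono fun k hk => ?_)
      exact ((ctrlNorm_bounds (hmem n k)).2.2.2 s t).trans (by gcongr; exact h n hn k hk)
  have hmm : (m, m') ∈ controlledSubmodule X β a b W := by
    obtain ⟨N, h⟩ := key 1 one_pos
    have := Submodule.sub_mem _ (ControlledPath.toPair_mem (u N)) (h N le_rfl).1
    rwa [sub_sub_cancel] at this
  refine ⟨ControlledPath.mk (m, m') hmm, Metric.tendsto_atTop.2 fun ε hε => ?_⟩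
  obtain ⟨N, h⟩ := key (ε / 5) (by positivity)
  refine ⟨N, fun n hn => ?_⟩
  rw [ControlledPath.dist_def]
  exact (h n hn).2.trans_lt (by linarith)

/-! ### Young integrals of little Hölder functions as controlled paths -/

theorem rpow_le_rpow_mul_rpow_sub {x T p q : ℝ} (hx : 0 ≤ x) (hxT : x ≤ T) (hp : 0 < p)
    (hpq : p ≤ q) : x ^ q ≤ T ^ (q - p) * x ^ p := by
  have h : x ^ q = x ^ (q - p) * x ^ p := by
    rw [← Real.rpow_add' hx (by linarith)]
    ring_nf
  rw [h]
  exact mul_le_mul_of_nonneg_right (Real.rpow_le_rpow hx hxT (by linarith)) (by positivity)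

theorem abs_sub_le_of_Icc (s t : Icc a b) : |(t : ℝ) - s| ≤ b - a :=
  abs_le.2 ⟨by linarith [s.2.1, s.2.2, t.2.1, t.2.2], by linarith [s.2.1, s.2.2, t.2.1, t.2.2]⟩

/-- Young integration is bounded from `α`-Hölder functions into the controlled paths of any
regularity `δ ≤ α / 2`. -/
theorem exists_ctrlNorm_young_le [ProperSpace W] (hab : a ≤ b) {Q α δ : ℝ} (hQ : 0 ≤ Q)
    (hγ : 0 < γ) (hδ : 0 < δ) (hδα : 2 * δ ≤ α) (hαγ : 1 < α + γ)
    (hX : ∀ s t : Icc a b, ‖X t - X s‖ ≤ Q * |(t : ℝ) - s| ^ γ) :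
    ∃ C, 0 ≤ C ∧ ∀ (A : ℝ) (f : Icc a b → E →L[ℝ] W) (g I : Icc a b → W), 0 ≤ A →
      (∀ t, ‖f t‖ ≤ A) → (∀ t, ‖g t‖ ≤ A) →
      (∀ s t : Icc a b, ‖f t - f s‖ ≤ A * |(t : ℝ) - s| ^ α) →
      (∀ s t : Icc a b, ‖g t - g s‖ ≤ A * |(t : ℝ) - s| ^ α) →
      (∀ t, HasYoungIntegral f X t (I t)) →
      ((fun t => I t + g t, f) : PathPair E W a b) ∈ controlledSubmodule X δ a b W ∧
        ctrlNorm X δ ((fun t => I t + g t, f) : PathPair E W a b) ≤ C * A := by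
  set K := youngConst (α + γ) with hK
  have hK0 : 0 ≤ K := youngConst_nonneg hαγ
  set T := b - a with hTdef
  have hT : 0 ≤ T := sub_nonneg.2 hab
  refine ⟨(K * Q * T ^ (α + γ) + Q * T ^ γ + 1) + 1 + T ^ (α - δ) +
    (K * Q * T ^ (α + γ - 2 * δ) + T ^ (α - 2 * δ)), by positivity,
    fun A f g I hA hf hg hf' hg' hI => ?_⟩
  obtain ⟨J, hJ, hJa, hJe⟩ := exists_youngIntegral hab hA hQ (by linarith : 0 < α) hγ hαγ hf' hX
  obtain rfl : I = J := funext fun t => (hI t).unique (hJ t)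
  have hd : ∀ s t : Icc a b, |(t : ℝ) - s| ≤ T := abs_sub_le_of_Icc
  refine (ctrlNorm_le (X := X) (β := δ)
    (x := ((fun t => I t + g t, f) : PathPair E W a b))
    (M₁ := (K * Q * T ^ (α + γ) + Q * T ^ γ + 1) * A) (M₂ := A) (M₃ := T ^ (α - δ) * A)
    (M₄ := (K * Q * T ^ (α + γ - 2 * δ) + T ^ (α - 2 * δ)) * A)
    (by positivity) hA (by positivity) (by positivity) (fun t => ?_) hf (fun s t => ?_)
    fun s t => ?_).imp_right fun h => h.trans (le_of_eq (by ring))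
  · have h1 := hJe ⟨a, le_rfl, hab⟩ t
    rw [hJa ⟨a, le_rfl, hab⟩ rfl, sub_zero] at h1
    have h2 : ‖f ⟨a, le_rfl, hab⟩ (X t - X a)‖ ≤ A * (Q * T ^ γ) := by
      refine (f _).le_of_opNorm_le_of_le (hf _) ((hX ⟨a, le_rfl, hab⟩ t).trans ?_)
      gcongr
      exact hd _ _
    have h3 : K * (A * Q) * |(t : ℝ) - a| ^ (α + γ) ≤ K * (A * Q) * T ^ (α + γ) := by
      gcongr
      exact hd ⟨a, le_rfl, hab⟩ t
    have h4 := norm_le_insert' (I t) (f ⟨a, le_rfl, hab⟩ (X t - X a))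
    have h5 := norm_add_le (I t) (g t)
    have h6 := hg t
    simp only at h1 h3 ⊢
    linarith
  · refine (hf' s t).trans ?_
    have := mul_le_mul_of_nonneg_left
      (rpow_le_rpow_mul_rpow_sub (abs_nonneg _) (hd s t) hδ (by linarith : δ ≤ α)) hA
    linarith
  · have heq : ctrlRemainder X ((fun t => I t + g t, f) : PathPair E W a b) s t =
        (I t - I s - f s (X t - X s)) + (g t - g s) := by
      simp only [ctrlRemainder]; abel
    rw [heq]
    refine (norm_add_le _ _).trans ((add_le_add (hJe s t) (hg' s t)).trans ?_)
    have h1 := mul_le_mul_of_nonneg_left (rpow_le_rpow_mul_rpow_sub (abs_nonneg _) (hd s t)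
      (by linarith : 0 < 2 * δ) (by linarith : 2 * δ ≤ α + γ))
      (mul_nonneg hK0 (mul_nonneg hA hQ))
    have h2 := mul_le_mul_of_nonneg_left (rpow_le_rpow_mul_rpow_sub (abs_nonneg _) (hd s t)
      (by linarith : 0 < 2 * δ) hδα) hA
    linarith

theorem exists_lipschitz_bound_of_contDiff {V : Type*} [NormedAddCommGroup V] [NormedSpace ℝ V]
    {F : ℝ → V} (hF : ContDiff ℝ ((⊤ : ℕ∞) : WithTop ℕ∞) F) (a b : ℝ) :
    ∃ A, 0 ≤ A ∧ (∀ t : Icc a b, ‖F t‖ ≤ A) ∧ ∀ s t : Icc a b, ‖F t - F s‖ ≤ A * |(t : ℝ) - s| := by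
  have hF1 : ContDiff ℝ 1 F := hF.of_le (by exact_mod_cast le_top)
  obtain ⟨C₁, h₁⟩ := (isCompact_Icc (a := a) (b := b)).exists_bound_of_continuousOn
    (hF1.continuous_deriv le_rfl).continuousOn
  obtain ⟨C₂, h₂⟩ := (isCompact_Icc (a := a) (b := b)).exists_bound_of_continuousOn
    hF.continuous.continuousOn
  refine ⟨max 0 (max C₁ C₂), le_max_left _ _, fun t => (h₂ t t.2).trans (by simp), fun s t => ?_⟩
  refine ((convex_Icc a b).norm_image_sub_le_of_norm_deriv_le
    (fun x _ => (hF1.differentiable one_ne_zero).differentiableAt) h₁ s.2 t.2).trans ?_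
  rw [Real.norm_eq_abs]
  gcongr
  simp

namespace MemLittleHolder

variable {V : Type*} [NormedAddCommGroup V] [NormedSpace ℝ V] {α : ℝ} {f g : Icc a b → V}

theorem of_contDiff {F : ℝ → V} (hF : ContDiff ℝ ((⊤ : ℕ∞) : WithTop ℕ∞) F) :
    MemLittleHolder α fun t : Icc a b => F t := by
  intro ε hε
  refine ⟨F, hF, fun t => by simpa using hε.le, fun s t => ?_⟩
  rw [sub_self, sub_self, sub_self, norm_zero]
  positivity

theorem add (hf : MemLittleHolder α f) (hg : MemLittleHolder α g) : MemLittleHolder α (f + g) := by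
  intro ε hε
  obtain ⟨F, hF, h1, h2⟩ := hf (ε / 2) (by positivity)
  obtain ⟨G, hG, k1, k2⟩ := hg (ε / 2) (by positivity)
  refine ⟨F + G, hF.add hG, fun t => ?_, fun s t => ?_⟩
  · rw [Pi.add_apply, Pi.add_apply, add_sub_add_comm]
    exact (norm_add_le _ _).trans (by linarith [h1 t, k1 t])
  · simp only [Pi.add_apply]
    rw [add_sub_add_comm, add_sub_add_comm (f s), add_sub_add_comm (f t - F t)]
    exact (norm_add_le _ _).trans (by linarith [h2 s t, k2 s t])

theorem const_smul (hf : MemLittleHolder α f) (c : ℝ) : MemLittleHolder α (c • f) := by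
  intro ε hε
  obtain ⟨F, hF, h1, h2⟩ := hf (ε / (|c| + 1)) (by positivity)
  have hc : |c| * (ε / (|c| + 1)) ≤ ε := by
    rw [← mul_div_assoc, div_le_iff₀ (by positivity)]
    nlinarith [abs_nonneg c]
  refine ⟨c • F, hF.const_smul c, fun t => ?_, fun s t => ?_⟩
  · rw [Pi.smul_apply, Pi.smul_apply, ← smul_sub, norm_smul, Real.norm_eq_abs]
    exact (mul_le_mul_of_nonneg_left (h1 t) (abs_nonneg c)).trans hc
  · simp only [Pi.smul_apply]
    rw [← smul_sub, ← smul_sub, ← smul_sub, norm_smul, Real.norm_eq_abs]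
    refine (mul_le_mul_of_nonneg_left (h2 s t) (abs_nonneg c)).trans ?_
    rw [← mul_assoc]
    gcongr

theorem exists_holder_bound (hα0 : 0 < α) (hα1 : α ≤ 1) (hf : MemLittleHolder α f) :
    ∃ A, 0 ≤ A ∧ (∀ t, ‖f t‖ ≤ A) ∧ ∀ s t : Icc a b, ‖f t - f s‖ ≤ A * |(t : ℝ) - s| ^ α := by
  obtain ⟨F, hF, h1, h2⟩ := hf 1 one_pos
  obtain ⟨A, hA, k1, k2⟩ := exists_lipschitz_bound_of_contDiff hF a b
  by_cases hab : a ≤ b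
  swap
  · exact ⟨0, le_rfl, fun t => absurd (t.2.1.trans t.2.2) hab,
      fun t => absurd (t.2.1.trans t.2.2) hab⟩
  have hT : 0 ≤ (b - a) ^ (1 - α) := Real.rpow_nonneg (sub_nonneg.2 hab) _
  refine ⟨1 + A * (1 + (b - a) ^ (1 - α)), by positivity, fun t => ?_, fun s t => ?_⟩
  · have := norm_le_insert' (f t) (F t)
    nlinarith [h1 t, k1 t, mul_nonneg hA hT]
  · have h3 := rpow_le_rpow_mul_rpow_sub (abs_nonneg _) (abs_sub_le_of_Icc s t) hα0 hα1
    rw [Real.rpow_one] at h3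
    have h4 := mul_le_mul_of_nonneg_left h3 hA
    have h5 : f t - f s = ((f t - F t) - (f s - F s)) + (F t - F s) := by abel
    have h6 : 0 ≤ A * |(t : ℝ) - s| ^ α := by positivity
    rw [h5]
    refine (norm_add_le _ _).trans ?_
    linarith [h2 s t, k2 s t]

end MemLittleHolder

/-- For little Hölder functions `f` and `g`, the Young integral of `f` shifted by `g` is a path
controlled by `X` that is approximated by the corresponding paths for smooth functions, which have
the regularity `γ`. -/
theorem exists_young_mem_controlledClosure [ProperSpace W] (hab : a ≤ b) {Q α : ℝ} (hQ : 0 ≤ Q)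
    (hβ : 0 < β) (hγ : 0 < γ) (hγ2 : 2 * γ ≤ 1) (hβα : 2 * β ≤ α) (hα1 : α ≤ 1) (hαγ : 1 < α + γ)
    (hX : ∀ s t : Icc a b, ‖X t - X s‖ ≤ Q * |(t : ℝ) - s| ^ γ)
    {f : Icc a b → E →L[ℝ] W} {g : Icc a b → W} (hf : MemLittleHolder α f)
    (hg : MemLittleHolder α g) :
    ∃ x ∈ controlledClosure X β γ a b W, x.gubinelli = f ∧
      ∀ t, HasYoungIntegral f X t (x.path t - g t) := by
  have hα0 : 0 < α := by linarith
  obtain ⟨C, hC0, hC⟩ := exists_ctrlNorm_young_le (W := W) hab hQ hγ hβ hβα hαγ hX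
  obtain ⟨C₁, -, hC₁⟩ := exists_ctrlNorm_young_le (W := W) (α := 1) hab hQ hγ hβ (by linarith)
    (by linarith) hX
  obtain ⟨C₂, -, hC₂⟩ := exists_ctrlNorm_young_le (W := W) (α := 1) hab hQ hγ hγ hγ2
    (by linarith) hX
  obtain ⟨A, hA, hf1, hf2⟩ := hf.exists_holder_bound hα0 hα1
  obtain ⟨A', hA', hg1, hg2⟩ := hg.exists_holder_bound hα0 hα1
  obtain ⟨I, hI, -, -⟩ := exists_youngIntegral hab hA hQ hα0 hγ hαγ hf2 hX
  have hx := (hC (max A A') f g I (le_max_of_le_left hA) (fun t => (hf1 t).trans (le_max_left _ _))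
    (fun t => (hg1 t).trans (le_max_right _ _))
    (fun s t => (hf2 s t).trans (by gcongr; exact le_max_left _ _))
    (fun s t => (hg2 s t).trans (by gcongr; exact le_max_right _ _)) hI).1
  refine ⟨ControlledPath.mk _ hx, ?_, rfl, fun t => ?_⟩
  swap
  · change HasYoungIntegral f X t (I t + g t - g t)
    rw [add_sub_cancel_right]
    exact hI t
  refine Metric.mem_closure_iff.2 fun η hη => ?_
  obtain ⟨F, hF, F1, F2⟩ := hf (η / (C + 1)) (by positivity)
  obtain ⟨G, hG, G1, G2⟩ := hg (η / (C + 1)) (by positivity)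
  obtain ⟨L, hL, L1, L2⟩ := exists_lipschitz_bound_of_contDiff hF a b
  obtain ⟨L', hL', L1', L2'⟩ := exists_lipschitz_bound_of_contDiff hG a b
  have L3 : ∀ s t : Icc a b, ‖F t - F s‖ ≤ L * |(t : ℝ) - s| ^ (1 : ℝ) := by simpa using L2
  obtain ⟨J, hJ, -, -⟩ := exists_youngIntegral (f := fun t : Icc a b => F t) hab hL hQ one_pos hγ
    (by linarith) L3 hX
  have e1 : ∀ t : Icc a b, ‖F t‖ ≤ max L L' := fun t => (L1 t).trans (le_max_left _ _)
  have e2 : ∀ t : Icc a b, ‖G t‖ ≤ max L L' := fun t => (L1' t).trans (le_max_right _ _)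
  have e3 : ∀ s t : Icc a b, ‖F t - F s‖ ≤ max L L' * |(t : ℝ) - s| ^ (1 : ℝ) := fun s t =>
    (L3 s t).trans (by gcongr; exact le_max_left _ _)
  have e4 : ∀ s t : Icc a b, ‖G t - G s‖ ≤ max L L' * |(t : ℝ) - s| ^ (1 : ℝ) := fun s t => by
    rw [Real.rpow_one]
    exact (L2' s t).trans (by gcongr; exact le_max_right _ _)
  have hy := (hC₁ _ _ (fun t : Icc a b => G t) J (le_max_of_le_left hL) e1 e2 e3 e4 hJ).1
  have hyγ := (hC₂ _ _ (fun t : Icc a b => G t) J (le_max_of_le_left hL) e1 e2 e3 e4 hJ).1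
  refine ⟨ControlledPath.mk _ hy, hyγ, ?_⟩
  rw [ControlledPath.dist_def, ControlledPath.toPair_mk, ControlledPath.toPair_mk]
  have hsub : ∀ t, HasYoungIntegral (fun t : Icc a b => f t - F t) X t (I t - J t) := fun t => by
    have := (hI t).add ((hJ t).const_smul (-1))
    convert this using 1
    · ext s; simp [sub_eq_add_neg]
    · simp [sub_eq_add_neg]
  have key := (hC (η / (C + 1)) (fun t => f t - F t) (fun t => g t - G t) (fun t => I t - J t)
    (by positivity) F1 G1 F2 G2 hsub).2
  have hpair : ((fun t => I t + g t, f) : PathPair E W a b) - (fun t => J t + G t, fun t : Icc a b => F t) =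
      (fun t => (I t - J t) + (g t - G t), fun t => f t - F t) := by
    refine Prod.ext (funext fun t => ?_) rfl
    exact add_sub_add_comm _ _ _ _
  refine lt_of_eq_of_lt (congrArg (ctrlNorm X β) hpair) (key.trans_lt ?_)
  rw [← mul_div_assoc, div_lt_iff₀ (by positivity)]
  nlinarith

end Controlled

/-! ### Smooth interpolation along a grid -/

section Interpolation

theorem exists_smoothTransition_lipschitz :
    ∃ L : ℝ, 1 ≤ L ∧ ∀ x y, |Real.smoothTransition x - Real.smoothTransition y| ≤ L * |x - y| := by
  obtain ⟨A, hA, -, h⟩ := exists_lipschitz_bound_of_contDiff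
    (F := Real.smoothTransition) Real.smoothTransition.contDiff 0 1
  refine ⟨1 + A, by linarith, fun x y => ?_⟩
  have h1 := h (projIcc 0 1 zero_le_one y) (projIcc 0 1 zero_le_one x)
  rw [Real.smoothTransition.projIcc, Real.smoothTransition.projIcc, Real.norm_eq_abs] at h1
  have h2 := abs_projIcc_sub_projIcc (zero_le_one' ℝ) (c := x) (d := y)
  nlinarith [abs_nonneg (x - y)]

theorem mul_rpow_sub_one_le {x h p : ℝ} (hx : 0 ≤ x) (hxh : x ≤ h) (hp : p ≤ 1) :
    x * h ^ (p - 1) ≤ x ^ p := by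
  rcases hx.eq_or_lt with rfl | hx
  · rw [zero_mul]; positivity
  · calc x * h ^ (p - 1) ≤ x * x ^ (p - 1) := by
          exact mul_le_mul_of_nonneg_left
            (Real.rpow_le_rpow_of_nonpos hx hxh (by linarith)) hx.le
      _ = x ^ p := by
          rw [Real.rpow_sub_one hx.ne']; field_simp

theorem rpow_le_rpow_sub_one_mul {x h p : ℝ} (hh : 0 < h) (hxh : h ≤ x) (hp : p ≤ 1) :
    x ^ p ≤ h ^ (p - 1) * x := by
  have hx : 0 < x := hh.trans_le hxh
  calc x ^ p = x ^ (p - 1) * x := by rw [Real.rpow_sub_one hx.ne']; field_simp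
    _ ≤ h ^ (p - 1) * x := by
      exact mul_le_mul_of_nonneg_right
        (Real.rpow_le_rpow_of_nonpos hh hxh (by linarith)) hx.le

/-- Every point of `[a, a + N h]` lies in a cell of the grid of mesh `h`. -/
theorem exists_cell {a h : ℝ} {N : ℕ} (hN : 0 < N) {t : ℝ} (hat : a ≤ t) (htN : t ≤ a + N * h) :
    ∃ j < N, a + j * h ≤ t ∧ t ≤ a + (j + 1 : ℕ) * h := by
  induction N with
  | zero => exact absurd hN (lt_irrefl 0)
  | succ n ih =>
    rcases Nat.eq_zero_or_pos n with rfl | hn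
    · exact ⟨0, zero_lt_one, by simpa using hat, htN⟩
    · rcases le_total t (a + n * h) with h1 | h1
      · obtain ⟨j, hj, h2⟩ := ih hn h1
        exact ⟨j, hj.trans n.lt_succ_self, h2⟩
      · exact ⟨n, n.lt_succ_self, h1, htN⟩

theorem grid_mono {a h : ℝ} (hh : 0 ≤ h) {i j : ℕ} (hij : i ≤ j) : a + i * h ≤ a + j * h := by
  gcongr

/-- Power bounds for an almost subadditive germ follow from those within the cells of a grid and
those between grid points. -/
theorem germ_le_of_grid {R : ℝ → ℝ → ℝ} {a h C C' p : ℝ} {N : ℕ} (hh : 0 < h) (hN : 0 < N)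
    (hp : 0 ≤ p) (hC : 0 ≤ C)
    (hcell : ∀ j < N, ∀ s t, a + j * h ≤ s → s ≤ t → t ≤ a + (j + 1 : ℕ) * h →
      R s t ≤ C * (t - s) ^ p)
    (hgrid : ∀ i j, i ≤ j → j ≤ N → R (a + i * h) (a + j * h) ≤
      C * ((a + j * h) - (a + i * h)) ^ p)
    (hadd : ∀ s u t, a ≤ s → s ≤ u → u ≤ t → t ≤ a + N * h →
      R s t ≤ R s u + R u t + C' * (t - s) ^ p) (hC' : 0 ≤ C')
    {s t : ℝ} (has : a ≤ s) (hst : s ≤ t) (htN : t ≤ a + N * h) :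
    R s t ≤ (3 * C + 2 * C') * (t - s) ^ p := by
  obtain ⟨i, hi, hi1, hi2⟩ := exists_cell hN has (hst.trans htN)
  have hpos : 0 ≤ (t - s) ^ p := Real.rpow_nonneg (by linarith) _
  rcases le_total t (a + (i + 1 : ℕ) * h) with h1 | h1
  · refine (hcell i hi s t hi1 hst h1).trans ?_
    gcongr
    linarith
  rcases h1.eq_or_lt with h1 | h1
  · refine (hcell i hi s t hi1 hst h1.ge).trans ?_
    gcongr
    linarith
  obtain ⟨j, hj, hj1, hj2⟩ := exists_cell hN (has.trans hst) htN
  have hij : i + 1 ≤ j := by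
    by_contra hcon
    have := grid_mono (a := a) hh.le (show j + 1 ≤ i + 1 by omega)
    linarith
  set u := a + (i + 1 : ℕ) * h with hu
  set v := a + (j : ℝ) * h with hv
  have huv : u ≤ v := grid_mono hh.le hij
  have e1 := hadd s u t has hi2 h1.le htN
  have e2 := hadd u v t (has.trans hi2) huv hj1 htN
  have e3 := hcell i hi s u hi1 hi2 le_rfl
  have e4 := hgrid (i + 1) j hij hj.le
  have e5 := hcell j hj v t le_rfl hj1 hj2
  have mono : ∀ x, 0 ≤ x → x ≤ t - s → x ^ p ≤ (t - s) ^ p := fun x h0 h =>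
    Real.rpow_le_rpow h0 h hp
  have f2 := mul_le_mul_of_nonneg_left (mono (t - u) (by linarith) (by linarith)) hC'
  have f3 := mul_le_mul_of_nonneg_left (mono (u - s) (by linarith) (by linarith)) hC
  have f4 := mul_le_mul_of_nonneg_left (mono (v - u) (by linarith) (by linarith)) hC
  have f5 := mul_le_mul_of_nonneg_left (mono (t - v) (by linarith) (by linarith)) hC
  linarith

variable {V : Type*} [NormedAddCommGroup V] [NormedSpace ℝ V]

/-- The smooth function with the value `c k` at the points `a + k h`, `k ≤ N`: on each cell it is
a rescaled smooth transition, all of whose derivatives vanish at the end points. -/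
noncomputable def smoothInterp (a h : ℝ) (N : ℕ) (c : ℕ → V) (t : ℝ) : V :=
  c 0 + ∑ k ∈ Finset.range N, Real.smoothTransition ((t - (a + k * h)) / h) • (c (k + 1) - c k)

theorem contDiff_smoothInterp (a h : ℝ) (N : ℕ) (c : ℕ → V) :
    ContDiff ℝ ((⊤ : ℕ∞) : WithTop ℕ∞) (smoothInterp a h N c) := by
  refine contDiff_const.add (ContDiff.sum fun k _ => ?_)
  exact (Real.smoothTransition.contDiff.comp
    ((contDiff_id.sub contDiff_const).div_const h)).smul contDiff_const

theorem smoothInterp_of_mem_cell {a h : ℝ} (hh : 0 < h) {N j : ℕ} (hj : j < N) (c : ℕ → V) {t : ℝ}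
    (h1 : a + j * h ≤ t) (h2 : t ≤ a + (j + 1 : ℕ) * h) :
    smoothInterp a h N c t =
      c j + Real.smoothTransition ((t - (a + j * h)) / h) • (c (j + 1) - c j) := by
  unfold smoothInterp
  rw [Finset.range_eq_Ico, ← Finset.sum_Ico_consecutive _ (Nat.zero_le j) hj.le,
    Finset.sum_eq_sum_Ico_succ_bot hj]
  have e1 : ∑ k ∈ Finset.Ico 0 j, Real.smoothTransition ((t - (a + k * h)) / h) • (c (k + 1) - c k)
      = c j - c 0 := by
    rw [← Finset.range_eq_Ico, ← Finset.sum_range_sub]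
    refine Finset.sum_congr rfl fun k hk => ?_
    rw [Real.smoothTransition.one_of_one_le, one_smul]
    have := grid_mono (a := a) hh.le (Nat.succ_le_of_lt (Finset.mem_range.1 hk))
    push_cast at this
    rw [le_div_iff₀ hh]
    linarith
  have e2 : ∑ k ∈ Finset.Ico (j + 1) N,
      Real.smoothTransition ((t - (a + k * h)) / h) • (c (k + 1) - c k) = 0 := by
    refine Finset.sum_eq_zero fun k hk => ?_
    have := grid_mono (a := a) hh.le (Finset.mem_Ico.1 hk).1
    rw [Real.smoothTransition.zero_of_nonpos, zero_smul]
    exact div_nonpos_of_nonpos_of_nonneg (by linarith) hh.le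
  rw [e1, e2]
  abel

theorem smoothInterp_grid {a h : ℝ} (hh : 0 < h) {N j : ℕ} (hN : 0 < N) (hj : j ≤ N) (c : ℕ → V) :
    smoothInterp a h N c (a + j * h) = c j := by
  rcases hj.eq_or_lt with rfl | hj
  · obtain ⟨n, rfl⟩ := Nat.exists_eq_succ_of_ne_zero hN.ne'
    rw [smoothInterp_of_mem_cell hh n.lt_succ_self c (grid_mono hh.le n.le_succ) le_rfl]
    have : (a + ((n + 1 : ℕ) : ℝ) * h - (a + n * h)) / h = 1 := by
      push_cast; field_simp; ring
    rw [Nat.succ_eq_add_one, this, Real.smoothTransition.one, one_smul]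
    abel
  · rw [smoothInterp_of_mem_cell hh hj c le_rfl (grid_mono hh.le j.le_succ)]
    simp

theorem norm_smoothInterp_sub_le_of_mem_cell {L : ℝ}
    (hL : ∀ x y, |Real.smoothTransition x - Real.smoothTransition y| ≤ L * |x - y|)
    {a h D : ℝ} (hh : 0 < h) (hL0 : 0 ≤ L) {N j : ℕ} (hj : j < N) {c : ℕ → V}
    (hc : ‖c (j + 1) - c j‖ ≤ D) {s t : ℝ} (h1 : a + j * h ≤ s) (hst : s ≤ t)
    (h2 : t ≤ a + (j + 1 : ℕ) * h) :
    ‖smoothInterp a h N c t - smoothInterp a h N c s‖ ≤ L * (D / h) * (t - s) := by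
  rw [smoothInterp_of_mem_cell hh hj c h1 (hst.trans h2),
    smoothInterp_of_mem_cell hh hj c (h1.trans hst) h2, add_sub_add_left_eq_sub, ← sub_smul,
    norm_smul, Real.norm_eq_abs]
  have h3 : |(t - (a + j * h)) / h - (s - (a + j * h)) / h| = (t - s) / h := by
    rw [← sub_div, sub_sub_sub_cancel_right, abs_of_nonneg (div_nonneg (by linarith) hh.le)]
  calc _ ≤ (L * ((t - s) / h)) * D := by
        refine mul_le_mul ((hL _ _).trans (by rw [h3])) hc (norm_nonneg _) ?_
        exact mul_nonneg hL0 (div_nonneg (by linarith) hh.le)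
    _ = _ := by ring

/-- The interpolation of a Hölder function along a grid is Hölder with a constant that does not
depend on the mesh, and Lipschitz. -/
theorem smoothInterp_holder {L : ℝ} (hL1 : 1 ≤ L)
    (hL : ∀ x y, |Real.smoothTransition x - Real.smoothTransition y| ≤ L * |x - y|)
    {a h A γ : ℝ} (hh : 0 < h) {N : ℕ} (hN : 0 < N) (hA : 0 ≤ A) (hγ : 0 < γ) (hγ1 : γ ≤ 1)
    {c : ℕ → V} (hc : ∀ i j, i ≤ j → j ≤ N →
      ‖c j - c i‖ ≤ A * ((a + j * h) - (a + i * h)) ^ γ) {s t : ℝ}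
    (has : a ≤ s) (hst : s ≤ t) (htN : t ≤ a + N * h) :
    ‖smoothInterp a h N c t - smoothInterp a h N c s‖ ≤ 3 * (L * A) * (t - s) ^ γ ∧
    ‖smoothInterp a h N c t - smoothInterp a h N c s‖ ≤
      3 * (L * A * h ^ (γ - 1)) * (t - s) := by
  have hL0 : 0 ≤ L := by linarith
  have hALA : A ≤ L * A := by nlinarith
  have hch : ∀ j < N, ‖c (j + 1) - c j‖ ≤ A * h ^ γ := fun j hj => by
    have := hc j (j + 1) j.le_succ hj
    rwa [show a + ((j + 1 : ℕ) : ℝ) * h - (a + j * h) = h by push_cast; ring] at this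
  have hdiv : A * h ^ γ / h = A * h ^ (γ - 1) := by
    rw [Real.rpow_sub_one hh.ne']; ring
  have hcell : ∀ j < N, ∀ s t, a + j * h ≤ s → s ≤ t → t ≤ a + (j + 1 : ℕ) * h →
      ‖smoothInterp a h N c t - smoothInterp a h N c s‖ ≤ L * A * h ^ (γ - 1) * (t - s) :=
    fun j hj s t h1 h2 h3 => by
      have := norm_smoothInterp_sub_le_of_mem_cell hL hh hL0 hj (hch j hj) h1 h2 h3
      rw [hdiv] at this
      linarith
  have htri : ∀ s u t, ‖smoothInterp a h N c t - smoothInterp a h N c s‖ ≤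
      ‖smoothInterp a h N c u - smoothInterp a h N c s‖ +
      ‖smoothInterp a h N c t - smoothInterp a h N c u‖ := fun s u t => by
    rw [add_comm]; exact norm_sub_le_norm_sub_add_norm_sub _ _ _
  constructor
  · have := germ_le_of_grid (R := fun s t => ‖smoothInterp a h N c t - smoothInterp a h N c s‖)
      (C := L * A) (C' := 0) (p := γ) hh hN hγ.le (by positivity) (fun j hj s t h1 h2 h3 => ?_)
      (fun i j hij hjN => ?_) (fun s u t _ _ _ _ => by simpa using htri s u t) le_rfl has hst htN
    · simpa using this
    · refine (hcell j hj s t h1 h2 h3).trans ?_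
      have := mul_rpow_sub_one_le (x := t - s) (h := h) (by linarith)
        (by push_cast at h3; linarith) hγ1
      calc _ = L * A * ((t - s) * h ^ (γ - 1)) := by ring
        _ ≤ _ := by gcongr
    · rw [smoothInterp_grid hh hN hjN, smoothInterp_grid hh hN (hij.trans hjN)]
      refine (hc i j hij hjN).trans ?_
      have : 0 ≤ a + (j : ℝ) * h - (a + i * h) := sub_nonneg.2 (grid_mono hh.le hij)
      gcongr
  · have := germ_le_of_grid (R := fun s t => ‖smoothInterp a h N c t - smoothInterp a h N c s‖)
      (C := L * A * h ^ (γ - 1)) (C' := 0) (p := 1) hh hN zero_le_one (by positivity)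
      (fun j hj s t h1 h2 h3 => ?_)
      (fun i j hij hjN => ?_) (fun s u t _ _ _ _ => by simpa using htri s u t) le_rfl has hst htN
    · simpa using this
    · rw [Real.rpow_one]
      exact hcell j hj s t h1 h2 h3
    · rw [smoothInterp_grid hh hN hjN, smoothInterp_grid hh hN (hij.trans hjN), Real.rpow_one]
      rcases hij.eq_or_lt with rfl | hlt
      · simp
      have hx : h ≤ a + (j : ℝ) * h - (a + i * h) := by
        have := grid_mono (a := a) hh.le (Nat.succ_le_of_lt hlt)
        push_cast at this
        linarith
      calc _ ≤ A * (a + (j : ℝ) * h - (a + i * h)) ^ γ := hc i j hij hjN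
        _ ≤ A * (h ^ (γ - 1) * (a + (j : ℝ) * h - (a + i * h))) := by
          gcongr
          exact rpow_le_rpow_sub_one_mul hh hx hγ1
        _ ≤ (L * A) * (h ^ (γ - 1) * (a + (j : ℝ) * h - (a + i * h))) := by
          have : 0 ≤ a + (j : ℝ) * h - (a + i * h) := by linarith
          gcongr
        _ = _ := by ring

end Interpolation

/-! ### Density of Young integrals of smooth functions -/

section Density

variable {E W : Type*} [NormedAddCommGroup E] [NormedSpace ℝ E]
  [NormedAddCommGroup W] [NormedSpace ℝ W]

/-- Interpolate the Gubinelli derivative `m'` of a controlled path along a grid, integrate the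
interpolation against `X`, and add the interpolation of the defect at the grid points. The resulting
path agrees with `m` at the grid points, its remainder is bounded uniformly in the mesh, and it is
uniformly close to `m`. -/
theorem controlled_interp_bounds {L : ℝ} (hL1 : 1 ≤ L)
    (hL : ∀ x y, |Real.smoothTransition x - Real.smoothTransition y| ≤ L * |x - y|)
    {a h A Q K B₁ B₃ γ : ℝ} (hh : 0 < h) {N : ℕ} (hN : 0 < N) (hA : 0 ≤ A) (hQ : 0 ≤ Q)
    (hK : 0 ≤ K) (hγ : 0 < γ) (hγ2 : 2 * γ ≤ 1) (hB₁ : B₁ = K * (3 * (L * A) * Q))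
    (hB₃ : B₃ = B₁ + L * (A + B₁))
    {X : ℝ → E} {m J : ℝ → W} {m' f : ℝ → E →L[ℝ] W} {g : ℝ → W}
    (hX : ∀ s t, a ≤ s → s ≤ t → t ≤ a + N * h → ‖X t - X s‖ ≤ Q * (t - s) ^ γ)
    (hm' : ∀ s t, a ≤ s → s ≤ t → t ≤ a + N * h → ‖m' t - m' s‖ ≤ A * (t - s) ^ γ)
    (hm : ∀ s t, a ≤ s → s ≤ t → t ≤ a + N * h →
      ‖m t - m s - m' s (X t - X s)‖ ≤ A * (t - s) ^ (2 * γ))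
    (hf : f = smoothInterp a h N fun k => m' (a + k * h))
    (hJ : ∀ s t, a ≤ s → s ≤ t → t ≤ a + N * h → ‖J t - J s - f s (X t - X s)‖ ≤
      K * (3 * (L * A * h ^ (γ - 1)) * Q) * (t - s) ^ (1 + γ))
    (hg : g = smoothInterp a h N fun k => m (a + k * h) - J (a + k * h)) :
    (∀ s t, a ≤ s → s ≤ t → t ≤ a + N * h → ‖(J t + g t) - (J s + g s) - f s (X t - X s)‖ ≤
      (3 * B₃ + 2 * (3 * (L * A) * Q)) * (t - s) ^ (2 * γ)) ∧
    ∀ t, a ≤ t → t ≤ a + N * h → ‖f t - m' t‖ ≤ (3 * (L * A) + A) * h ^ γ ∧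
      ‖J t + g t - m t‖ ≤ (3 * B₃ + 2 * (3 * (L * A) * Q) + A) * h ^ (2 * γ) := by
  have hL0 : 0 ≤ L := by linarith
  have hB₁0 : 0 ≤ B₁ := by rw [hB₁]; positivity
  have hB₃0 : 0 ≤ B₃ := by rw [hB₃]; positivity
  have hAB₃ : A ≤ B₃ := by rw [hB₃]; nlinarith
  have hga : ∀ j : ℕ, a ≤ a + j * h := fun j => by
    have : 0 ≤ j * h := by positivity
    linarith
  have hgN : ∀ j : ℕ, j ≤ N → a + j * h ≤ a + N * h := fun j hj => grid_mono hh.le hj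
  have hstep : ∀ j : ℕ, a + ((j + 1 : ℕ) : ℝ) * h - (a + j * h) = h := fun j => by
    push_cast; ring
  have hsq : ∀ x : ℝ, 0 ≤ x → x ^ γ * x ^ γ = x ^ (2 * γ) := fun x hx => by
    rw [← Real.rpow_add' hx (by linarith)]; ring_nf
  have hfH : ∀ s t, a ≤ s → s ≤ t → t ≤ a + N * h → ‖f t - f s‖ ≤ 3 * (L * A) * (t - s) ^ γ :=
    fun s t h1 h2 h3 => by
      rw [hf]
      exact (smoothInterp_holder hL1 hL hh hN hA hγ (by linarith)
        (fun i j hij hj => hm' _ _ (hga i) (grid_mono hh.le hij) (hgN j hj)) h1 h2 h3).1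
  have hfg : ∀ j ≤ N, f (a + j * h) = m' (a + j * h) := fun j hj => by
    rw [hf]; exact smoothInterp_grid hh hN hj _
  have hgg : ∀ j ≤ N, J (a + j * h) + g (a + j * h) = m (a + j * h) := fun j hj => by
    rw [hg, smoothInterp_grid hh hN hj]; abel
  -- On a cell the Lipschitz constant of `f` is compensated by the length of the interval.
  have hJc : ∀ s t, a ≤ s → s ≤ t → t ≤ a + N * h → t - s ≤ h →
      ‖J t - J s - f s (X t - X s)‖ ≤ B₁ * (t - s) ^ (2 * γ) := fun s t h1 h2 h3 h4 => by
    refine (hJ s t h1 h2 h3).trans ?_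
    have hx : 0 ≤ t - s := by linarith
    have h5 := mul_rpow_sub_one_le hx h4 (by linarith : γ ≤ 1)
    rw [Real.rpow_add' hx (by linarith), Real.rpow_one, ← hsq _ hx, hB₁]
    calc _ = K * (3 * (L * A) * Q) * (((t - s) * h ^ (γ - 1)) * (t - s) ^ γ) := by ring
      _ ≤ _ := by gcongr
  have hgc : ∀ j < N, ∀ s t, a + j * h ≤ s → s ≤ t → t ≤ a + (j + 1 : ℕ) * h →
      ‖g t - g s‖ ≤ L * (A + B₁) * (t - s) ^ (2 * γ) := fun j hj s t h1 h2 h3 => by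
    have e : ‖(m (a + (j + 1 : ℕ) * h) - J (a + (j + 1 : ℕ) * h)) - (m (a + j * h) - J (a + j * h))‖
        ≤ (A + B₁) * h ^ (2 * γ) := by
      have k1 := hm (a + j * h) (a + (j + 1 : ℕ) * h) (hga j) (grid_mono hh.le j.le_succ) (hgN _ hj)
      have k2 := hJc (a + j * h) (a + (j + 1 : ℕ) * h) (hga j) (grid_mono hh.le j.le_succ)
        (hgN _ hj) (hstep j).le
      rw [hstep j] at k1 k2
      rw [hfg j hj.le] at k2
      have : (m (a + (j + 1 : ℕ) * h) - J (a + (j + 1 : ℕ) * h)) - (m (a + j * h) - J (a + j * h)) =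
          (m (a + (j + 1 : ℕ) * h) - m (a + j * h) -
            m' (a + j * h) (X (a + (j + 1 : ℕ) * h) - X (a + j * h))) -
          (J (a + (j + 1 : ℕ) * h) - J (a + j * h) -
            m' (a + j * h) (X (a + (j + 1 : ℕ) * h) - X (a + j * h))) := by abel
      rw [this, add_mul]
      exact (norm_sub_le _ _).trans (add_le_add k1 k2)
    rw [hg]
    refine (norm_smoothInterp_sub_le_of_mem_cell hL hh hL0 hj e h1 h2 h3).trans ?_
    have k := mul_rpow_sub_one_le (x := t - s) (h := h) (by linarith)
      (by push_cast at h3; linarith) hγ2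
    rw [Real.rpow_sub_one hh.ne'] at k
    calc _ = L * (A + B₁) * ((t - s) * (h ^ (2 * γ) / h)) := by ring
      _ ≤ _ := by gcongr
  have hR : ∀ s t, a ≤ s → s ≤ t → t ≤ a + N * h → ‖(J t + g t) - (J s + g s) - f s (X t - X s)‖ ≤
      (3 * B₃ + 2 * (3 * (L * A) * Q)) * (t - s) ^ (2 * γ) := by
    intro s t h1 h2 h3
    refine germ_le_of_grid (R := fun s t => ‖(J t + g t) - (J s + g s) - f s (X t - X s)‖) hh hN
      (by linarith) hB₃0 (fun j hj s t h1 h2 h3 => ?_) (fun i j hij hj => ?_)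
      (fun s u t h1 h2 h3 h4 => ?_) (by positivity) h1 h2 h3
    · have k1 := hJc s t ((hga j).trans h1) h2 (h3.trans (hgN _ hj)) (by
        have := hstep j; linarith)
      have k2 := hgc j hj s t h1 h2 h3
      have : (J t + g t) - (J s + g s) - f s (X t - X s) =
          (J t - J s - f s (X t - X s)) + (g t - g s) := by abel
      rw [this, hB₃, add_mul]
      exact (norm_add_le _ _).trans (add_le_add k1 k2)
    · rw [hgg j hj, hgg i (hij.trans hj), hfg i (hij.trans hj)]
      refine (hm _ _ (hga i) (grid_mono hh.le hij) (hgN j hj)).trans ?_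
      have : 0 ≤ a + (j : ℝ) * h - (a + i * h) := sub_nonneg.2 (grid_mono hh.le hij)
      gcongr
    · have k : ‖(f u - f s) (X t - X u)‖ ≤ 3 * (L * A) * Q * (t - s) ^ (2 * γ) := by
        refine ((f u - f s).le_of_opNorm_le_of_le (hfH s u h1 h2 (h3.trans h4))
          (hX u t (h1.trans h2) h3 h4)).trans ?_
        rw [← hsq _ (by linarith)]
        have i1 : 0 ≤ u - s := by linarith
        have i2 : 0 ≤ t - u := by linarith
        have i3 : 0 ≤ t - s := by linarith
        calc _ ≤ 3 * (L * A) * (t - s) ^ γ * (Q * (t - s) ^ γ) := by gcongr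
          _ = _ := by ring
      have : (J t + g t) - (J s + g s) - f s (X t - X s) =
          ((J u + g u) - (J s + g s) - f s (X u - X s)) +
          ((J t + g t) - (J u + g u) - f u (X t - X u)) + (f u - f s) (X t - X u) := by
        simp only [map_sub, _root_.sub_apply]; abel
      rw [this]
      exact (norm_add₃_le).trans (by gcongr)
  refine ⟨hR, fun t h1 h2 => ?_⟩
  obtain ⟨j, hj, j1, j2⟩ := exists_cell hN h1 h2
  have hjh : t - (a + j * h) ≤ h := by have := hstep j; linarith
  have hj0 : 0 ≤ t - (a + j * h) := by linarith
  have k1 := hfH _ _ (hga j) j1 h2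
  have k2 := hm' _ _ (hga j) j1 h2
  have k3 := hR _ _ (hga j) j1 h2
  have k4 := hm _ _ (hga j) j1 h2
  rw [hfg j hj.le] at k1 k3
  rw [hgg j hj.le] at k3
  constructor
  · have : f t - m' t = (f t - m' (a + j * h)) - (m' t - m' (a + j * h)) := by abel
    rw [this, add_mul]
    refine (norm_sub_le _ _).trans (add_le_add (k1.trans ?_) (k2.trans ?_)) <;> gcongr
  · have : J t + g t - m t =
        (J t + g t - m (a + j * h) - m' (a + j * h) (X t - X (a + j * h))) -
        (m t - m (a + j * h) - m' (a + j * h) (X t - X (a + j * h))) := by abel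
    rw [this, add_mul]
    refine (norm_sub_le _ _).trans (add_le_add (k3.trans ?_) (k4.trans ?_)) <;> gcongr

theorem le_mul_rpow_of_le_rpow {v C x h p q : ℝ} (hx : 0 ≤ x) (hh : 0 < h) (hp : 0 < p)
    (hpq : p ≤ q) (hC : 0 ≤ C) (h₁ : v ≤ C * x ^ q) (h₂ : v ≤ C * h ^ q) :
    v ≤ C * h ^ (q - p) * x ^ p := by
  rcases le_total x h with hxh | hxh
  · refine h₁.trans ?_
    rw [mul_assoc]
    exact mul_le_mul_of_nonneg_left (rpow_le_rpow_mul_rpow_sub hx hxh hp hpq) hC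
  · refine h₂.trans ?_
    rw [mul_assoc]
    refine mul_le_mul_of_nonneg_left ?_ hC
    calc h ^ q = h ^ (q - p) * h ^ p := by rw [← Real.rpow_add hh]; ring_nf
      _ ≤ _ := by gcongr

variable {a b β γ : ℝ} {X : ℝ → E}

/-- Interpolation between uniform smallness and boundedness in the regularity `γ` gives smallness
in any lower regularity `β`. -/
theorem ctrlNorm_le_of_uniform {Q C h : ℝ} (hQ : 0 ≤ Q) (hC : 0 ≤ C) (hh : 0 < h) (hβ : 0 < β)
    (hβγ : β ≤ γ) (hab : a ≤ b)
    (hX : ∀ s t : Icc a b, ‖X t - X s‖ ≤ Q * |(t : ℝ) - s| ^ γ)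
    {w : PathPair E W a b} (h₁ : ∀ t, ‖w.1 t‖ ≤ C * h ^ γ) (h₂ : ∀ t, ‖w.2 t‖ ≤ C * h ^ γ)
    (h₃ : ∀ s t : Icc a b, s ≤ t → ‖w.2 t - w.2 s‖ ≤ C * |(t : ℝ) - s| ^ γ)
    (h₄ : ∀ s t : Icc a b, s ≤ t → ‖ctrlRemainder X w s t‖ ≤ C * |(t : ℝ) - s| ^ (2 * γ)) :
    w ∈ controlledSubmodule X β a b W ∧ ctrlNorm X β w ≤ C * h ^ γ + C * h ^ γ +
      2 * C * h ^ (γ - β) + C * (2 + Q * (b - a) ^ γ + Q) * h ^ (γ - β) := by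
  have hT : 0 ≤ b - a := sub_nonneg.2 hab
  have h₃' : ∀ s t : Icc a b, ‖w.2 t - w.2 s‖ ≤ C * |(t : ℝ) - s| ^ γ := fun s t => by
    rcases le_total s t with hst | hst
    · exact h₃ s t hst
    · rw [norm_sub_rev, abs_sub_comm]
      exact h₃ t s hst
  have h₄' : ∀ s t : Icc a b, ‖ctrlRemainder X w s t‖ ≤ C * (1 + Q) * |(t : ℝ) - s| ^ (2 * γ) := by
    intro s t
    have hnn : 0 ≤ C * Q * |(t : ℝ) - s| ^ (2 * γ) := by positivity
    rcases le_total s t with hst | hst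
    · linarith [h₄ s t hst]
    · have e : ctrlRemainder X w s t =
          (w.2 t - w.2 s) (X t - X s) - ctrlRemainder X w t s := by
        simp only [ctrlRemainder, map_sub, _root_.sub_apply]; abel
      have k1 := (w.2 t - w.2 s).le_of_opNorm_le_of_le (h₃' s t) (hX s t)
      have k2 := h₄ t s hst
      rw [abs_sub_comm] at k2
      have k3 : |(t : ℝ) - s| ^ (2 * γ) = |(t : ℝ) - s| ^ γ * |(t : ℝ) - s| ^ γ := by
        rw [← Real.rpow_add' (abs_nonneg _) (by linarith)]; ring_nf
      rw [e]
      refine (norm_sub_le _ _).trans ((add_le_add k1 k2).trans (le_of_eq ?_))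
      rw [k3]; ring
  refine ctrlNorm_le (by positivity) (by positivity) (by positivity) (by positivity) h₁ h₂
    (fun s t => ?_) fun s t => ?_
  · refine le_mul_rpow_of_le_rpow (abs_nonneg _) hh hβ hβγ (by positivity) ((h₃' s t).trans ?_) ?_
    · gcongr
      linarith
    · refine (norm_sub_le _ _).trans ?_
      linarith [h₂ s, h₂ t]
  · have hs : 0 < √h := Real.sqrt_pos.2 hh
    have hpow : ∀ p : ℝ, √h ^ (2 * p) = h ^ p := fun p => by
      rw [Real.sqrt_eq_rpow, ← Real.rpow_mul hh.le]
      ring_nf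
    -- The uniform bound is only of order `h ^ γ`, whence the square root.
    have := le_mul_rpow_of_le_rpow (v := ‖ctrlRemainder X w s t‖)
      (C := C * (2 + Q * (b - a) ^ γ + Q)) (h := √h) (q := 2 * γ) (p := 2 * β)
      (abs_nonneg ((t : ℝ) - s)) hs (by linarith) (by linarith) (by positivity)
      ((h₄' s t).trans ?_) ?_
    · rwa [← mul_sub, hpow] at this
    · gcongr
      have : 0 ≤ Q * (b - a) ^ γ := by positivity
      linarith
    · rw [hpow]
      have k1 : ‖w.2 s (X t - X s)‖ ≤ C * h ^ γ * (Q * (b - a) ^ γ) := by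
        refine (w.2 s).le_of_opNorm_le_of_le (h₂ s) ((hX s t).trans ?_)
        have := abs_sub_le_of_Icc s t
        have hγ : 0 ≤ γ := by linarith
        gcongr
      have k2 : ‖ctrlRemainder X w s t‖ ≤ ‖w.1 t‖ + ‖w.1 s‖ + ‖w.2 s (X t - X s)‖ :=
        (norm_sub_le _ _).trans (add_le_add (norm_sub_le _ _) le_rfl)
      have k3 : 0 ≤ C * Q * h ^ γ := by positivity
      linarith [h₁ s, h₁ t]

/-- Controlled paths of regularity `γ` are approximated, in any lower regularity `β`, by Young
integrals of smooth interpolations. -/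
theorem exists_interp_ctrlNorm_le [ProperSpace W] (hab : a < b) {Q : ℝ} (hQ : 0 ≤ Q) (hβ : 0 < β)
    (hβγ : β < γ) (hγ2 : 2 * γ ≤ 1)
    (hX : ∀ s t : Icc a b, ‖X t - X s‖ ≤ Q * |(t : ℝ) - s| ^ γ)
    {x : PathPair E W a b} (hx : x ∈ controlledSubmodule X γ a b W) {η : ℝ} (hη : 0 < η) :
    ∃ (N : ℕ) (c : ℕ → E →L[ℝ] W) (e : ℕ → W) (I : Icc a b → W),
      (∀ t, HasYoungIntegral (fun t : Icc a b => smoothInterp a ((b - a) / N) N c t) X t (I t)) ∧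
      ctrlNorm X β (((fun t => I t + smoothInterp a ((b - a) / N) N e t,
        fun t : Icc a b => smoothInterp a ((b - a) / N) N c t) : PathPair E W a b) - x) ≤ η := by
  have hγ : 0 < γ := hβ.trans hβγ
  obtain ⟨L, hL1, hL⟩ := exists_smoothTransition_lipschitz
  have hL0 : 0 ≤ L := by linarith
  obtain ⟨-, -, hx3, hx4⟩ := ctrlNorm_bounds hx
  have hA : 0 ≤ ctrlNorm X γ x := ctrlNorm_nonneg X γ x
  set A := ctrlNorm X γ x with hAdef
  set K := youngConst (1 + γ) with hKdef
  have hK : 0 ≤ K := youngConst_nonneg (by linarith)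
  obtain ⟨B₁, hB₁⟩ : ∃ B₁, B₁ = K * (3 * (L * A) * Q) := ⟨_, rfl⟩
  obtain ⟨B₃, hB₃⟩ : ∃ B₃, B₃ = B₁ + L * (A + B₁) := ⟨_, rfl⟩
  have hB₁0 : 0 ≤ B₁ := by rw [hB₁]; positivity
  have hB₃0 : 0 ≤ B₃ := by rw [hB₃]; positivity
  have hT : 0 < b - a := sub_pos.2 hab
  set D := 3 * B₃ + 2 * (3 * (L * A) * Q) + A with hD
  have hD0 : 0 ≤ D := by positivity
  set C := (3 * (L * A) + A) + D + D * (b - a) ^ γ with hC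
  have hC0 : 0 ≤ C := by positivity
  have hDT : 0 ≤ D * (b - a) ^ γ := by positivity
  have hLA : 0 ≤ 3 * (L * A) + A := by positivity
  obtain ⟨N, hN, hNη⟩ : ∃ N : ℕ, 0 < N ∧ C * ((b - a) / N) ^ γ + C * ((b - a) / N) ^ γ +
      2 * C * ((b - a) / N) ^ (γ - β) +
      C * (2 + Q * (b - a) ^ γ + Q) * ((b - a) / N) ^ (γ - β) < η := by
    have hlim : Tendsto (fun N : ℕ => (b - a) / (N : ℝ)) atTop (𝓝 0) :=
      tendsto_const_div_atTop_nhds_zero_nat (b - a)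
    have l1 := hlim.rpow_const (p := γ) (Or.inr hγ.le)
    have l2 := hlim.rpow_const (p := γ - β) (Or.inr (by linarith))
    rw [Real.zero_rpow hγ.ne'] at l1
    rw [Real.zero_rpow (by linarith)] at l2
    have := (((l1.const_mul C).add (l1.const_mul C)).add (l2.const_mul (2 * C))).add
      (l2.const_mul (C * (2 + Q * (b - a) ^ γ + Q)))
    simp only [mul_zero, add_zero] at this
    obtain ⟨N, h1, h2⟩ := ((this.eventually (gt_mem_nhds hη)).and (eventually_gt_atTop 0)).exists
    exact ⟨N, h2, h1⟩
  have hNR : (0 : ℝ) < N := by exact_mod_cast hN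
  set h := (b - a) / N with hh_def
  have hh : 0 < h := by positivity
  have hb : a + N * h = b := by rw [hh_def]; field_simp; ring
  have hhT : h ≤ b - a := by
    have : (1 : ℝ) ≤ N := by exact_mod_cast hN
    nlinarith
  set π : ℝ → Icc a b := projIcc a b hab.le with hπ
  have hπe : ∀ t : Icc a b, π t = t := projIcc_val hab.le
  have hπv : ∀ t, a ≤ t → t ≤ b → (π t : ℝ) = t := fun t h1 h2 => by
    rw [hπ, projIcc_of_mem hab.le ⟨h1, h2⟩]
  have hX' : ∀ s t, a ≤ s → s ≤ t → t ≤ a + N * h → ‖X t - X s‖ ≤ Q * (t - s) ^ γ :=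
    fun s t h1 h2 h3 => by
      have := hX ⟨s, h1, by linarith⟩ ⟨t, h1.trans h2, by linarith⟩
      rwa [abs_of_nonneg (by simpa using h2)] at this
  have hm' : ∀ s t, a ≤ s → s ≤ t → t ≤ a + N * h →
      ‖x.2 (π t) - x.2 (π s)‖ ≤ A * (t - s) ^ γ := fun s t h1 h2 h3 => by
    have := hx3 (π s) (π t)
    rwa [hπv s h1 (by linarith), hπv t (h1.trans h2) (by linarith),
      abs_of_nonneg (by linarith)] at this
  have hm : ∀ s t, a ≤ s → s ≤ t → t ≤ a + N * h →
      ‖x.1 (π t) - x.1 (π s) - x.2 (π s) (X t - X s)‖ ≤ A * (t - s) ^ (2 * γ) :=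
    fun s t h1 h2 h3 => by
      have := hx4 (π s) (π t)
      unfold ctrlRemainder at this
      rwa [hπv s h1 (by linarith), hπv t (h1.trans h2) (by linarith),
        abs_of_nonneg (by linarith)] at this
  obtain ⟨f, hf⟩ : ∃ f, f = smoothInterp a h N fun k => x.2 (π (a + k * h)) := ⟨_, rfl⟩
  have hfb : ∀ s t, a ≤ s → s ≤ t → t ≤ a + N * h → ‖f t - f s‖ ≤ 3 * (L * A) * (t - s) ^ γ ∧
      ‖f t - f s‖ ≤ 3 * (L * A * h ^ (γ - 1)) * (t - s) := fun s t h1 h2 h3 => by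
    rw [hf]
    refine smoothInterp_holder hL1 hL hh hN hA hγ (by linarith) (fun i j hij hj => ?_) h1 h2 h3
    refine hm' _ _ ?_ (grid_mono hh.le hij) (grid_mono hh.le hj)
    have : 0 ≤ i * h := by positivity
    linarith
  have hfLip : ∀ s t : Icc a b, ‖f t - f s‖ ≤
      3 * (L * A * h ^ (γ - 1)) * |(t : ℝ) - s| ^ (1 : ℝ) := fun s t => by
    rw [Real.rpow_one]
    rcases le_total s t with hst | hst
    · have hst' : (s : ℝ) ≤ t := hst
      rw [abs_of_nonneg (by linarith)]
      exact (hfb s t s.2.1 hst (by linarith [t.2.2])).2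
    · have hst' : (t : ℝ) ≤ s := hst
      rw [abs_of_nonpos (by linarith), neg_sub, norm_sub_rev]
      exact (hfb t s t.2.1 hst (by linarith [s.2.2])).2
  obtain ⟨I, hI, -, hIe⟩ := exists_youngIntegral (f := fun t : Icc a b => f t) hab.le
    (by positivity) hQ one_pos hγ (by linarith) hfLip hX
  have hJ : ∀ s t, a ≤ s → s ≤ t → t ≤ a + N * h → ‖I (π t) - I (π s) - f s (X t - X s)‖ ≤
      K * (3 * (L * A * h ^ (γ - 1)) * Q) * (t - s) ^ (1 + γ) := fun s t h1 h2 h3 => by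
    have := hIe (π s) (π t)
    rwa [hπv s h1 (by linarith), hπv t (h1.trans h2) (by linarith),
      abs_of_nonneg (by linarith)] at this
  obtain ⟨g, hg⟩ : ∃ g, g = smoothInterp a h N fun k =>
    x.1 (π (a + k * h)) - I (π (a + k * h)) := ⟨_, rfl⟩
  obtain ⟨r1, r2⟩ := controlled_interp_bounds (m := fun t => x.1 (π t)) (m' := fun t => x.2 (π t))
    (J := fun t => I (π t)) hL1 hL hh hN hA hQ hK hγ hγ2 hB₁ hB₃ hX' hm' hm hf hJ hg
  refine ⟨N, fun k => x.2 (π (a + k * h)), fun k => x.1 (π (a + k * h)) - I (π (a + k * h)), I,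
    ?_, ?_⟩
  · rw [← hf]; exact hI
  rw [← hf, ← hg]
  have hlow : ∀ t : Icc a b, (t : ℝ) ≤ a + N * h := fun t => t.2.2.trans hb.ge
  refine (ctrlNorm_le_of_uniform hQ hC0 hh hβ hβγ.le hab.le hX (fun t => ?_) (fun t => ?_)
    (fun s t hst => ?_) fun s t hst => ?_).2.trans hNη.le
  · have := (r2 t t.2.1 (hlow t)).2
    simp only [hπe] at this
    refine this.trans ?_
    have e1 := mul_le_mul_of_nonneg_left
      (rpow_le_rpow_mul_rpow_sub hh.le hhT hγ (by linarith : γ ≤ 2 * γ)) hD0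
    rw [show 2 * γ - γ = γ by ring] at e1
    have e2 : 0 ≤ (3 * (L * A) + A) * h ^ γ := by positivity
    have e3 : 0 ≤ D * h ^ γ := by positivity
    rw [hC]
    linarith
  · have := (r2 t t.2.1 (hlow t)).1
    simp only [hπe] at this
    refine this.trans ?_
    gcongr
    linarith
  · have hst' : (s : ℝ) ≤ t := hst
    have e1 := (hfb s t s.2.1 hst (hlow t)).1
    have e2 := hx3 s t
    rw [abs_of_nonneg (by linarith)] at e2 ⊢
    have : (f t - x.2 t) - (f s - x.2 s) = (f t - f s) - (x.2 t - x.2 s) := by abel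
    change ‖(f t - x.2 t) - (f s - x.2 s)‖ ≤ _
    rw [this]
    refine (norm_sub_le _ _).trans ((add_le_add e1 e2).trans ?_)
    rw [← add_mul]
    have : 0 ≤ (t : ℝ) - s := by linarith
    gcongr
    linarith
  · have hst' : (s : ℝ) ≤ t := hst
    have e1 := r1 s t s.2.1 hst (hlow t)
    simp only [hπe] at e1
    have e2 := hx4 s t
    rw [abs_of_nonneg (by linarith)] at e2 ⊢
    rw [ctrlRemainder_sub]
    refine (norm_sub_le _ _).trans ((add_le_add e1 e2).trans ?_)
    rw [← add_mul]
    have : 0 ≤ (t : ℝ) - s := by linarith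
    gcongr
    linarith

end Density

/-! ### Measurability of the norm -/

section Measurability

/-- A supremum of lower semicontinuous functions over a separable space is attained along a
countable dense set, hence measurable. -/
theorem measurable_ciSup_of_lowerSemicontinuous {Ω T : Type*} [MeasurableSpace Ω]
    [TopologicalSpace T] [TopologicalSpace.SeparableSpace T] [Nonempty T] {q : Ω → T → ℝ}
    (hm : ∀ p, Measurable fun ω => q ω p) (hq : ∀ ω, LowerSemicontinuous (q ω))
    (hb : ∀ ω, BddAbove (range (q ω))) : Measurable fun ω => ⨆ p, q ω p := by
  have heq : ∀ ω, ⨆ p, q ω p = ⨆ n, q ω (TopologicalSpace.denseSeq T n) := fun ω => by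
    have hb' : BddAbove (range fun n => q ω (TopologicalSpace.denseSeq T n)) :=
      (hb ω).mono (by rintro _ ⟨n, rfl⟩; exact ⟨_, rfl⟩)
    refine le_antisymm (ciSup_le fun p => ?_) (ciSup_le fun n => le_ciSup (hb ω) _)
    by_contra hcon
    push Not at hcon
    obtain ⟨_, ⟨n, rfl⟩, h1⟩ := (TopologicalSpace.denseRange_denseSeq T).inter_nhds_nonempty
      (hq ω p _ hcon)
    exact absurd (le_ciSup hb' n) (not_le.2 h1)
  simp only [heq]
  exact Measurable.iSup fun n => hm _

theorem lowerSemicontinuous_div_rpow {a b β : ℝ} (hβ : 0 < β) {n : Icc a b × Icc a b → ℝ}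
    (hn : Continuous n) (hn0 : ∀ p, 0 ≤ n p) :
    LowerSemicontinuous fun p : Icc a b × Icc a b => n p / |(p.2 : ℝ) - p.1| ^ β := by
  intro p
  by_cases hp : (p.2 : ℝ) - p.1 = 0
  -- On the diagonal the quotient is `n p / 0 = 0`, its least value.
  · intro y hy
    simp only [hp, abs_zero, Real.zero_rpow hβ.ne', div_zero] at hy
    exact Filter.Eventually.of_forall fun p' => hy.trans_le (div_nonneg (hn0 _) (by positivity))
  · refine ContinuousAt.lowerSemicontinuousAt ?_
    have h1 : Continuous fun p : Icc a b × Icc a b => |(p.2 : ℝ) - p.1| := by fun_prop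
    exact hn.continuousAt.div (h1.continuousAt.rpow_const (Or.inr hβ.le))
      (by have := abs_pos.2 hp; positivity)

variable {E W : Type*} [NormedAddCommGroup E] [NormedSpace ℝ E]
  [NormedAddCommGroup W] [NormedSpace ℝ W] {a b β γ : ℝ} {X : ℝ → E}

theorem continuous_snd_of_mem_controlledSubmodule (hβ : 0 < β) {x : PathPair E W a b}
    (hx : x ∈ controlledSubmodule X β a b W) : Continuous x.2 :=
  continuous_of_norm_sub_le_rpow hβ (ctrlNorm_bounds hx).2.2.1

theorem continuous_fst_of_mem_controlledSubmodule (hβ : 0 < β)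
    (hX : Continuous fun t : Icc a b => X t) {x : PathPair E W a b}
    (hx : x ∈ controlledSubmodule X β a b W) : Continuous x.1 := by
  obtain ⟨-, -, -, h4⟩ := ctrlNorm_bounds hx
  refine continuous_iff_continuousAt.2 fun s => tendsto_iff_norm_sub_tendsto_zero.2 ?_
  have l1 : Tendsto (fun t : Icc a b => x.2 s (X t - X s)) (𝓝 s) (𝓝 0) := by
    have : Continuous fun t : Icc a b => x.2 s (X t - X s) :=
      (x.2 s).continuous.comp (hX.sub continuous_const)
    simpa using this.tendsto s
  have l2 : Tendsto (fun t : Icc a b => ctrlNorm X β x * |(t : ℝ) - s| ^ (2 * β)) (𝓝 s) (𝓝 0) := by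
    have h1 : Continuous fun t : Icc a b => |(t : ℝ) - s| := by fun_prop
    have := ((h1.tendsto s).rpow_const (p := 2 * β) (Or.inr (by linarith))).const_mul
      (ctrlNorm X β x)
    simpa [Real.zero_rpow (by linarith : 2 * β ≠ 0)] using this
  have l3 := l2.add l1.norm
  rw [norm_zero, add_zero] at l3
  refine squeeze_zero (fun _ => norm_nonneg _) (fun t => ?_) l3
  have e : x.1 t - x.1 s = ctrlRemainder X x s t + x.2 s (X t - X s) := by
    simp only [ctrlRemainder]; abel
  rw [e]
  exact (norm_add_le _ _).trans (add_le_add (h4 s t) le_rfl)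

theorem measurable_ctrlNorm {Ω : Type*} [MeasurableSpace Ω] (hab : a ≤ b) (hβ : 0 < β)
    {X : Ω → ℝ → E} (hXc : ∀ ω, Continuous fun t : Icc a b => X ω t)
    (hXm : ∀ t, StronglyMeasurable fun ω => X ω t) {x : Ω → PathPair E W a b}
    (hx : ∀ ω, x ω ∈ controlledSubmodule (X ω) β a b W)
    (h₁ : ∀ t, StronglyMeasurable fun ω => (x ω).1 t)
    {f : Icc a b → E →L[ℝ] W} (h₂ : ∀ ω, (x ω).2 = f) :
    Measurable fun ω => ctrlNorm (X ω) β (x ω) := by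
  have : Nonempty (Icc a b) := ⟨⟨a, le_rfl, hab⟩⟩
  have hc1 : ∀ ω, Continuous (x ω).1 := fun ω =>
    continuous_fst_of_mem_controlledSubmodule hβ (hXc ω) (hx ω)
  have hc2 : ∀ ω, Continuous (x ω).2 := fun ω =>
    continuous_snd_of_mem_controlledSubmodule hβ (hx ω)
  refine ((Measurable.add ?_ ?_).add ?_).add ?_
  · exact measurable_ciSup_of_lowerSemicontinuous (fun t => (h₁ t).norm.measurable)
      (fun ω => (hc1 ω).norm.lowerSemicontinuous) (fun ω => (hx ω).1)
  · simp only [h₂]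
    exact measurable_const
  · simp only [derivQuot, h₂]
    exact measurable_const
  · refine measurable_ciSup_of_lowerSemicontinuous (fun p => ?_) (fun ω => ?_)
      (fun ω => (hx ω).2.2.2)
    · have : StronglyMeasurable fun ω => ctrlRemainder (X ω) (x ω) p.1 p.2 := by
        simp only [ctrlRemainder, h₂]
        exact ((h₁ _).sub (h₁ _)).sub
          ((f p.1).continuous.comp_stronglyMeasurable ((hXm _).sub (hXm _)))
      exact this.norm.measurable.div_const _
    · refine lowerSemicontinuous_div_rpow (by linarith : 0 < 2 * β)
        (n := fun p => ‖ctrlRemainder (X ω) (x ω) p.1 p.2‖) ?_ fun p => norm_nonneg _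
      have k1 := hc1 ω
      have k2 := hc2 ω
      have k3 := hXc ω
      refine Continuous.norm ?_
      refine ((k1.comp continuous_snd).sub (k1.comp continuous_fst)).sub ?_
      exact (k2.comp continuous_fst).clm_apply ((k3.comp continuous_snd).sub
        (k3.comp continuous_fst))

/-- Young integrals depend measurably on the integrator, as limits of Riemann sums. -/
theorem HasYoungIntegral.stronglyMeasurable {Ω : Type*} [MeasurableSpace Ω]
    {X : Ω → ℝ → E} (hXm : ∀ t, StronglyMeasurable fun ω => X ω t)
    {f : Icc a b → E →L[ℝ] W} {t : Icc a b} {I : Ω → W}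
    (hI : ∀ ω, HasYoungIntegral f (X ω) t (I ω)) : StronglyMeasurable I := by
  obtain ⟨N, p, h⟩ := exists_partitions_tendsto_youngIntegral (E := E) (W := W) t
  refine stronglyMeasurable_of_tendsto atTop (f := fun n ω => ∑ k ∈ Finset.range (N n),
    f (p n k) (X ω (p n (k + 1)) - X ω (p n k))) (fun n => ?_)
    (tendsto_pi_nhds.2 fun ω => h f (X ω) (I ω) (hI ω))
  exact Finset.stronglyMeasurable_fun_sum _ fun k _ =>
    (f (p n k)).continuous.comp_stronglyMeasurable ((hXm _).sub (hXm _))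

end Measurability

/-! ### Sections given by Young integrals -/

section Sections

theorem smoothInterp_congr {V : Type*} [NormedAddCommGroup V] [NormedSpace ℝ V] {a h : ℝ} {N : ℕ}
    {c c' : ℕ → V} (hc : ∀ k ≤ N, c k = c' k) : smoothInterp a h N c = smoothInterp a h N c' := by
  funext t
  unfold smoothInterp
  rw [hc 0 (Nat.zero_le _)]
  congr 1
  refine Finset.sum_congr rfl fun k hk => ?_
  have hk := Finset.mem_range.1 hk
  rw [hc k hk.le, hc (k + 1) hk]

theorem smoothInterp_add {V : Type*} [NormedAddCommGroup V] [NormedSpace ℝ V] (a h : ℝ) (N : ℕ)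
    (c c' : ℕ → V) (t : ℝ) :
    smoothInterp a h N (c + c') t = smoothInterp a h N c t + smoothInterp a h N c' t := by
  simp only [smoothInterp, Pi.add_apply]
  rw [add_add_add_comm, ← Finset.sum_add_distrib]
  congr 1
  refine Finset.sum_congr rfl fun k _ => ?_
  rw [← smul_add]
  congr 1
  abel

theorem smoothInterp_smul {V : Type*} [NormedAddCommGroup V] [NormedSpace ℝ V] (a h : ℝ) (N : ℕ)
    (r : ℝ) (c : ℕ → V) (t : ℝ) :
    smoothInterp a h N (r • c) t = r • smoothInterp a h N c t := by
  simp only [smoothInterp, Pi.smul_apply, smul_add, Finset.smul_sum]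
  congr 1
  refine Finset.sum_congr rfl fun k _ => ?_
  rw [← smul_sub, smul_comm]

variable {Ω : Type*} {d : ℕ} {γ r β : ℝ} {B : Ω → DelayedRoughPath d γ r}
  {W : Type*} [NormedAddCommGroup W] [NormedSpace ℝ W]

theorem DelayedRoughPath.exists_holder_bound (D : DelayedRoughPath d γ r) (a b : ℝ) :
    ∃ Q, 0 ≤ Q ∧ ∀ s t : Icc a b, ‖D.X t - D.X s‖ ≤ Q * |(t : ℝ) - s| ^ γ := by
  obtain ⟨C, hC⟩ := D.holder_X a b
  refine ⟨max 0 C, le_max_left _ _, fun s t => (hC s s.2 t t.2).trans ?_⟩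
  gcongr
  exact le_max_right _ _

namespace IsYoungSection

variable {f f' : Icc (-r) 0 → EuclideanSpace ℝ (Fin d) →L[ℝ] W} {g g' : Icc (-r) 0 → W}
  {σ τ : ∀ ω, ControlledField B β W ω}

theorem zero : IsYoungSection B β (0 : Icc (-r) 0 → EuclideanSpace ℝ (Fin d) →L[ℝ] W) 0 0 := by
  refine fun ω => ⟨rfl, fun t => ?_⟩
  have : HasYoungIntegral (0 : Icc (-r) 0 → EuclideanSpace ℝ (Fin d) →L[ℝ] W) (B ω).X t 0 :=
    fun ε hε => ⟨1, one_pos, fun n p ξ _ _ _ _ => by simpa using hε⟩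
  convert this using 1
  exact sub_zero (0 : W)

theorem add (h : IsYoungSection B β f g σ) (h' : IsYoungSection B β f' g' τ) :
    IsYoungSection B β (f + f') (g + g') (σ + τ) := by
  refine fun ω => ⟨?_, fun t => ?_⟩
  · rw [← (h ω).1, ← (h' ω).1]; rfl
  · have := ((h ω).2 t).add ((h' ω).2 t)
    convert this using 1
    exact add_sub_add_comm _ _ _ _

theorem const_smul (h : IsYoungSection B β f g σ) (c : ℝ) :
    IsYoungSection B β (c • f) (c • g) (c • σ) := by
  refine fun ω => ⟨?_, fun t => ?_⟩
  · rw [← (h ω).1]; rfl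
  · have := ((h ω).2 t).const_smul c
    convert this using 1
    exact (smul_sub c ((σ ω).1.path t) (g t)).symm

theorem unique (h : IsYoungSection B β f g σ) (h' : IsYoungSection B β f g τ) : σ = τ := by
  funext ω
  refine Subtype.ext (ControlledPath.toPair_injective (Prod.ext (funext fun t => ?_) ?_))
  · exact sub_left_injective (((h ω).2 t).unique ((h' ω).2 t))
  · exact (h ω).1.trans (h' ω).1.symm

theorem measurable_norm [MeasurableSpace Ω] (hr : 0 < r) (hβ : 0 < β) (hγ : 0 < γ)
    (hX : ∀ t, Measurable fun ω => (B ω).X t) (h : IsYoungSection B β f g σ) :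
    Measurable fun ω => ‖σ ω‖ := by
  have hXm : ∀ t, StronglyMeasurable fun ω => (B ω).X t := fun t => (hX t).stronglyMeasurable
  refine measurable_ctrlNorm (X := fun ω => (B ω).X) (x := fun ω => ControlledPath.toPair (σ ω).1)
    (by linarith) hβ (fun ω => ?_) hXm (fun ω => ControlledPath.toPair_mem _) (fun t => ?_)
    (f := f) fun ω => (h ω).1
  · obtain ⟨Q, -, hQ⟩ := (B ω).exists_holder_bound (-r) 0
    exact continuous_of_norm_sub_le_rpow hγ hQ
  · have := (HasYoungIntegral.stronglyMeasurable hXm (fun ω => (h ω).2 t)).add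
      (stronglyMeasurable_const (b := g t))
    convert this using 2 with ω
    exact (sub_add_cancel _ _).symm

end IsYoungSection

theorem existsUnique_isYoungSection [ProperSpace W] (hr : 0 < r) (hβ : 0 < β)
    (hγ : 0 < γ) (hγ2 : 2 * γ ≤ 1) {α : ℝ} (hβα : 2 * β ≤ α) (hα1 : α ≤ 1) (hαγ : 1 < α + γ)
    {f : Icc (-r) 0 → EuclideanSpace ℝ (Fin d) →L[ℝ] W} {g : Icc (-r) 0 → W}
    (hf : MemLittleHolder α f) (hg : MemLittleHolder α g) :
    ∃! σ : ∀ ω, ControlledField B β W ω, IsYoungSection B β f g σ := by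
  have hex : ∀ ω, ∃ x ∈ controlledClosure (B ω).X β γ (-r) 0 W, x.gubinelli = f ∧
      ∀ t, HasYoungIntegral f (B ω).X t (x.path t - g t) := fun ω => by
    obtain ⟨Q, hQ, hX⟩ := (B ω).exists_holder_bound (-r) 0
    exact exists_young_mem_controlledClosure (by linarith) hQ hβ hγ hγ2 hβα hα1 hαγ hX hf hg
  choose x hx hx1 hx2 using hex
  refine ⟨fun ω => ⟨x ω, hx ω⟩, fun ω => ⟨hx1 ω, hx2 ω⟩, fun τ hτ => hτ.unique ?_⟩
  exact fun ω => ⟨hx1 ω, hx2 ω⟩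

/-- The space of all sections given by Young integrals of little Hölder functions. -/
def youngSections (B : Ω → DelayedRoughPath d γ r) (β α : ℝ) (W : Type*) [NormedAddCommGroup W]
    [NormedSpace ℝ W] : Submodule ℝ (∀ ω, ControlledField B β W ω) where
  carrier := {σ | ∃ f g, MemLittleHolder α f ∧ MemLittleHolder α g ∧ IsYoungSection B β f g σ}
  add_mem' := by
    rintro σ τ ⟨f, g, hf, hg, h⟩ ⟨f', g', hf', hg', h'⟩
    exact ⟨_, _, hf.add hf', hg.add hg', h.add h'⟩
  zero_mem' := ⟨_, _, MemLittleHolder.of_contDiff (F := fun _ => 0) contDiff_const,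
    MemLittleHolder.of_contDiff (F := fun _ => 0) contDiff_const, IsYoungSection.zero⟩
  smul_mem' := by
    rintro c σ ⟨f, g, hf, hg, h⟩
    exact ⟨_, _, hf.const_smul c, hg.const_smul c, h.const_smul c⟩

/-- The values at the grid points from which interpolations with `N` cells are formed. -/
abbrev GridValues (d N : ℕ) (W : Type*) [NormedAddCommGroup W] [NormedSpace ℝ W] : Type _ :=
  (Fin (N + 1) → EuclideanSpace ℝ (Fin d) →L[ℝ] W) × (Fin (N + 1) → W)

/-- The interpolation of finitely many values along the grid with `N` cells in `[-r, 0]`. -/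
noncomputable def gridInterp {V : Type*} [NormedAddCommGroup V] [NormedSpace ℝ V] (r : ℝ) (N : ℕ)
    (c : Fin (N + 1) → V) (t : Icc (-r) 0) : V :=
  smoothInterp (-r) ((0 - -r) / N) N (fun k => c (Fin.ofNat (N + 1) k)) t

theorem gridInterp_add {V : Type*} [NormedAddCommGroup V] [NormedSpace ℝ V] (N : ℕ)
    (c c' : Fin (N + 1) → V) : gridInterp r N (c + c') = gridInterp r N c + gridInterp r N c' :=
  funext fun _ => smoothInterp_add _ _ _ _ _ _

theorem gridInterp_smul {V : Type*} [NormedAddCommGroup V] [NormedSpace ℝ V] (N : ℕ) (x : ℝ)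
    (c : Fin (N + 1) → V) : gridInterp r N (x • c) = x • gridInterp r N c :=
  funext fun _ => smoothInterp_smul _ _ _ _ _ _

theorem memLittleHolder_gridInterp {V : Type*} [NormedAddCommGroup V] [NormedSpace ℝ V] {α : ℝ}
    (N : ℕ) (c : Fin (N + 1) → V) : MemLittleHolder α (gridInterp r N c) :=
  MemLittleHolder.of_contDiff (contDiff_smoothInterp _ _ _ _)

theorem gridInterp_restrict {V : Type*} [NormedAddCommGroup V] [NormedSpace ℝ V] (N : ℕ)
    (c : ℕ → V) : (gridInterp r N fun i => c i) =
      fun t : Icc (-r) 0 => smoothInterp (-r) ((0 - -r) / N) N c t := by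
  funext t
  unfold gridInterp
  rw [smoothInterp_congr (c' := c)]
  intro k hk
  simp only [Fin.val_ofNat]
  rw [Nat.mod_eq_of_lt (by omega)]

/-- The Young integrals of interpolations of values in a countable dense set are dense in every
fibre. For a fixed number of cells the integral is a linear function of finitely many values, hence
continuous. -/
theorem isMeasurableSections_youngSections [MeasurableSpace Ω] [FiniteDimensional ℝ W]
    (hr : 0 < r) (hβ : 0 < β) (hβγ : β < γ) (hγ2 : 2 * γ ≤ 1) {α : ℝ} (hβα : 2 * β ≤ α) (hα1 : α ≤ 1) (hαγ : 1 < α + γ)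
    (hX : ∀ t, Measurable fun ω => (B ω).X t) :
    IsMeasurableSections (ControlledField B β W) (youngSections B β α W) := by
  have : ProperSpace W := FiniteDimensional.proper_real W
  have hγ : 0 < γ := hβ.trans hβγ
  have hex : ∀ (N : ℕ) (p : GridValues d N W), ∃ σ : ∀ ω, ControlledField B β W ω,
      IsYoungSection B β (gridInterp r N p.1) (gridInterp r N p.2) σ := fun N p =>
    (existsUnique_isYoungSection hr hβ hγ hγ2 hβα hα1 hαγ (memLittleHolder_gridInterp N p.1)
      (memLittleHolder_gridInterp N p.2)).exists
  choose S hS using hex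
  have hfin : ∀ N, FiniteDimensional ℝ (GridValues d N W) := fun N => inferInstance
  have hsep : ∀ N, TopologicalSpace.SeparableSpace (GridValues d N W) := fun N => by
    have : ProperSpace (GridValues d N W) := FiniteDimensional.proper_real _
    infer_instance
  have hcont : ∀ N ω, Continuous fun p => S N p ω := fun N ω => by
    let T : GridValues d N W →ₗ[ℝ] ControlledField B β W ω :=
      { toFun := fun p => S N p ω
        map_add' := fun p q => by
          have h : IsYoungSection B β (gridInterp r N (p + q).1) (gridInterp r N (p + q).2)
              (S N p + S N q) := by
            rw [Prod.fst_add, Prod.snd_add, gridInterp_add, gridInterp_add]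
            exact (hS N p).add (hS N q)
          exact congrFun ((hS N (p + q)).unique h) ω
        map_smul' := fun c p => by
          have h : IsYoungSection B β (gridInterp r N (c • p).1) (gridInterp r N (c • p).2)
              (c • S N p) := by
            rw [Prod.smul_fst, Prod.smul_snd, gridInterp_smul, gridInterp_smul]
            exact (hS N p).const_smul c
          exact congrFun ((hS N (c • p)).unique h) ω }
    exact T.continuous_of_finiteDimensional
  choose A hAc hAd using fun N => TopologicalSpace.exists_countable_dense (GridValues d N W)
  refine ⟨⟨⋃ N, S N '' A N, ?_, countable_iUnion fun N => (hAc N).image _, fun ω => ?_⟩, ?_⟩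
  · refine iUnion_subset fun N => ?_
    rintro _ ⟨p, -, rfl⟩
    exact ⟨_, _, memLittleHolder_gridInterp N p.1, memLittleHolder_gridInterp N p.2, hS N p⟩
  · have hcl : ∀ N p, S N p ω ∈ closure ((fun g : (∀ ω, ControlledField B β W ω) => g ω) ''
        ⋃ N, S N '' A N) := fun N p =>
      map_mem_closure (hcont N ω) (hAd N p) fun q hq =>
        ⟨S N q, mem_iUnion.2 ⟨N, q, hq, rfl⟩, rfl⟩
    intro y
    rw [← closure_closure]
    refine Metric.mem_closure_iff.2 fun η hη => ?_
    obtain ⟨x, hxγ, hxy⟩ := Metric.mem_closure_iff.1 y.2 (η / 2) (by positivity)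
    obtain ⟨Q, hQ, hXQ⟩ := (B ω).exists_holder_bound (-r) 0
    obtain ⟨N, c, e, I, hI, hN⟩ := exists_interp_ctrlNorm_le (by linarith : -r < 0) hQ hβ hβγ hγ2
      hXQ (x := ControlledPath.toPair x) hxγ (η := η / 3) (by positivity)
    refine ⟨S N (fun i => c i, fun i => e i) ω, hcl N _, ?_⟩
    obtain ⟨h1, h2⟩ := hS N (fun i => c i, fun i => e i) ω
    simp only [gridInterp_restrict] at h1 h2
    have hpair : ControlledPath.toPair (S N (fun i => c i, fun i => e i) ω).1 =
        (fun t => I t + smoothInterp (-r) ((0 - -r) / N) N e t,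
          fun t : Icc (-r) 0 => smoothInterp (-r) ((0 - -r) / N) N c t) := by
      refine Prod.ext (funext fun t => ?_) h1
      exact sub_eq_iff_eq_add.1 ((h2 t).unique (hI t))
    rw [← hpair, ← ControlledPath.dist_def] at hN
    rw [Subtype.dist_eq]
    refine (dist_triangle _ x _).trans_lt ?_
    rw [dist_comm x]
    linarith
  · rintro σ ⟨f, g, -, -, h⟩
    exact h.measurable_norm hr hβ hγ hX

end Sections

theorem theorem4p7 {Ω : Type*} [MeasurableSpace Ω] (P : Measure Ω) (θ : ℝ → Ω → Ω) {d : ℕ}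
    {W : Type*} [NormedAddCommGroup W] [NormedSpace ℝ W] [FiniteDimensional ℝ W]
    {H β γ r : ℝ} (hH : H < 1 / 2) (hβ : 1 / 3 < β) (hβγ : β < γ) (hγH : γ < H) (hr : 0 < r)
    (hθ : IsErgodicMetricDynamicalSystem P θ) (B : Ω → DelayedRoughPath d γ r)
    (hB : IsDelayedRoughPathCocycle θ B) (hfBm : IsFractionalBrownianLift H P B) :
    IsMeasurableFieldOfBanachSpaces (ControlledField B β W) ∧
    ∀ ε : ℝ, 0 < ε → ε ≤ 1 - 2 * β →
      (∀ (f : Icc (-r) 0 → EuclideanSpace ℝ (Fin d) →L[ℝ] W) (g : Icc (-r) 0 → W),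
        MemLittleHolder (1 - ε) f → MemLittleHolder (1 - ε) g →
        ∃! σ : ∀ ω, ControlledField B β W ω, IsYoungSection B β f g σ) ∧
      ∃ Δ : Submodule ℝ (∀ ω, ControlledField B β W ω),
        IsMeasurableSections (ControlledField B β W) Δ ∧
        (Δ : Set (∀ ω, ControlledField B β W ω)) =
          {σ | ∃ f g, MemLittleHolder (1 - ε) f ∧ MemLittleHolder (1 - ε) g ∧
            IsYoungSection B β f g σ} := by
  have : ProperSpace W := FiniteDimensional.proper_real W
  have hsec : ∀ ε : ℝ, 0 < ε → ε ≤ 1 - 2 * β →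
      IsMeasurableSections (ControlledField B β W) (youngSections B β (1 - ε) W) := fun ε hε hεβ =>
    isMeasurableSections_youngSections hr (by linarith) hβγ (by linarith) (by linarith)
      (by linarith) (by linarith) hB.measurable_X
  refine ⟨⟨fun ω => (Submodule.isClosed_topologicalClosure _).completeSpace_coe,
    _, hsec (1 - 2 * β) (by linarith) le_rfl⟩, fun ε hε hεβ => ⟨fun f g hf hg => ?_,
    _, hsec ε hε hεβ, rfl⟩⟩
  exact existsUnique_isYoungSection hr (by linarith) (by linarith) (by linarith)
    (by linarith) (by linarith) (by linarith) hf hg
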